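/- Let $G$ be a nontrivial compact connected (Hausdorff) Abelian group with normalized Haar measure $m$ and character group $X$. Let $X_+\subseteq X$ be a positive cone: a subsemigroup containing the identity character $1$ with $X_+\cap X_+^{-1}=\{1\}$ and $X_+\cup X_+^{-1}=X$. Put $X_-=X\setminus X_+$ and $\hat f(\chi)=\int_G f\,\overline{\chi}\,dm$, and let $H^2(G)$ be the space of all $f\in L^2(G)$ with $\hat f(\chi)=0$ for all $\chi\in X_-$, with the inner product $\langle\cdot,\cdot\rangle$ of $L^2(G)$ (linear in the first argument). Let $\lambda\in G$ and let $T_{\lambda,\varphi}=T$ be a $\lambda$-Toeplitz operator with symbol $\varphi\in L^2(G)$. That is, $T$ is a bounded linear operator on $H^2(G)$ with $\langle T(\chi\xi),\chi\eta\rangle=\chi(\lambda)\langle T\xi,\eta\rangle$ for all $\chi,\xi,\eta\in X_+$, and $\hat\varphi(\chi)=\langle T1,\chi\rangle$ for $\chi\in X_+$, $\hat\varphi(\chi)=\langle T\chi^{-1},1\rangle$ for $\chi\in X_-$. Let $\varphi_\lambda\in L^2(G)$ be its modified symbol: $\widehat{\varphi_\lambda}(\chi)=\overline{\chi(\lambda)}\,\hat\varphi(\chi)$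 for $\chi\in X_+$ and $\widehat{\varphi_\lambda}(\chi)=\hat\varphi(\chi)$ for $\chi\in X_-$. The rotation index of a character $\chi\in X$ is defined by $\operatorname{ind}\chi=\sharp(X_+\setminus\chi X_+)$ if $\chi\in X_+$ and $X_+\setminus\chi X_+$ is finite, and by $\operatorname{ind}\chi=\operatorname{ind}\chi_1-\operatorname{ind}\chi_2$ if $\chi=\chi_1\chi_2^{-1}$ with $\chi_1,\chi_2\in X_+$ and both sets $X_+\setminus\chi_jX_+$ finite; in all other cases $\chi$ has no index. Let $X^i$ be the set of characters that have an index, let $\Phi(G)=X^i\exp(C(G))$, and put $\operatorname{ind}(\chi e^{g})=\operatorname{ind}\chi$ for $\chi\in X^i$, $g\in C(G)$. Suppose that $\varphi_\lambda\in C(G)$. Then $T_{\lambda,\varphi}$ is Fredholm (finite-dimensional kernel, closed image of finite codimension) if and only if $\varphi_\lambda\in\Phi(G)$. In this case $\operatorname{ind}\varphi_\lambda$ is well defined and $$\operatorname{Ind}T_{\lambda,\varphi}=\dim\ker T_{\lambda,\varphi}-\dim\bigl(H^2(G)/\operatorname{Im}T_{\lambda,\varphi}\bigr)=-\operatorname{ind}\varphi_\lambda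 .$$ -/

import Mathlib

open MeasureTheory
open scoped ComplexConjugate Pointwise

noncomputable section

namespace LambdaToeplitz

variable {G : Type*} [CommGroup G] [TopologicalSpace G] [IsTopologicalGroup G] [CompactSpace G]
  [MeasurableSpace G] [BorelSpace G]

/-- A character of `G`, regarded as a complex-valued continuous function. -/
def charFun (χ : PontryaginDual G) : C(G, ℂ) where
  toFun x := (χ x : ℂ)
  continuous_toFun := by fun_prop

/-- The Fourier coefficient `∫ f(x) * conj (χ x) dm(x)` of `f` at the character `χ`. -/
def fourierCoeff (m : Measure G) (f : G → ℂ) (χ : PontryaginDual G) : ℂ :=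
  ∫ x, f x * conj (χ x : ℂ) ∂m

/-- A character of `G`, as an element of `L²(G)`. -/
def charL2 (m : Measure G) [IsFiniteMeasure m] (χ : PontryaginDual G) : Lp ℂ 2 m :=
  ContinuousMap.toLp 2 m ℂ (charFun χ)

/-- Fourier coefficients of elements of `L²(G)` are inner products with characters; Mathlib's
inner product is linear in its second argument. -/
lemma fourierCoeff_eq_inner (m : Measure G) [IsFiniteMeasure m] (f : Lp ℂ 2 m)
    (χ : PontryaginDual G) : fourierCoeff m f χ = inner ℂ (charL2 m χ) f := by
  rw [L2.inner_def]
  apply integral_congr_ae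
  filter_upwards [ContinuousMap.coeFn_toLp (p := 2) (𝕜 := ℂ) m (charFun χ)] with x hx
  simp only [charL2, hx]
  rfl

lemma integral_char_of_ne_one (m : Measure G) [m.IsHaarMeasure] (χ : PontryaginDual G)
    (hχ : χ ≠ 1) : ∫ x, (χ x : ℂ) ∂m = 0 := by
  obtain ⟨a, ha⟩ : ∃ a, χ a ≠ 1 := by
    by_contra! h
    exact hχ (PontryaginDual.ext h)
  have h := integral_mul_left_eq_self (μ := m) (fun x => (χ x : ℂ)) a
  simp only [map_mul, Circle.coe_mul, integral_const_mul] at h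
  have h' : ((χ a : ℂ) - 1) * ∫ x, (χ x : ℂ) ∂m = 0 := by rw [sub_mul, h]; ring
  refine (mul_eq_zero.mp h').resolve_left fun h0 => ha ?_
  exact Circle.ext (by simpa using sub_eq_zero.mp h0)

/-- Distinct characters are orthogonal. -/
lemma fourierCoeff_charL2_of_ne (m : Measure G) [m.IsHaarMeasure] [IsFiniteMeasure m]
    (ξ χ : PontryaginDual G) (h : ξ ≠ χ) : fourierCoeff m (charL2 m ξ) χ = 0 := by
  rw [← integral_char_of_ne_one m (ξ * χ⁻¹) (by rwa [Ne, mul_inv_eq_one])]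
  apply integral_congr_ae
  filter_upwards [ContinuousMap.coeFn_toLp (p := 2) (𝕜 := ℂ) m (charFun ξ)] with x hx
  simp only [charL2, hx]
  change (ξ x : ℂ) * conj (χ x : ℂ) = ((ξ x * (χ x)⁻¹ : Circle) : ℂ)
  rw [Circle.coe_mul, Circle.coe_inv_eq_conj]

/-- The Hardy space `H²(G)`: the functions in `L²(G)` whose Fourier transform is concentrated on
the positive cone `P = X₊` of the character group. -/
def H2 (m : Measure G) [IsFiniteMeasure m] (P : GroupCone (PontryaginDual G)) :
    Submodule ℂ (Lp ℂ 2 m) where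
  carrier := {f | ∀ χ, χ ∉ P → fourierCoeff m f χ = 0}
  zero_mem' χ _ := by rw [fourierCoeff_eq_inner, inner_zero_right]
  add_mem' {f g} hf hg χ hχ := by
    rw [fourierCoeff_eq_inner, inner_add_right, ← fourierCoeff_eq_inner, ← fourierCoeff_eq_inner,
      hf χ hχ, hg χ hχ, add_zero]
  smul_mem' c f hf χ hχ := by
    rw [fourierCoeff_eq_inner, inner_smul_right, ← fourierCoeff_eq_inner, hf χ hχ, mul_zero]

variable (m : Measure G) [m.IsHaarMeasure] [IsFiniteMeasure m]
  (P : GroupCone (PontryaginDual G))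

/-- A positive character, as an element of `H²(G)`. -/
def charH2 (χ : P) : H2 m P :=
  ⟨charL2 m χ, fun ψ hψ => fourierCoeff_charL2_of_ne m χ ψ fun h => hψ (h ▸ χ.2)⟩

/-- `T` is `lam`-Toeplitz: `⟨T(χξ), χη⟩ = lam(χ) ⟨Tξ, η⟩` for all positive characters `χ, ξ, η`.
(The inner product on paper is linear in the first argument, Mathlib's in the second.) -/
def IsLambdaToeplitz (lam : P → ℂ) (T : H2 m P →L[ℂ] H2 m P) : Prop :=
  ∀ χ ξ η : P, inner ℂ (charH2 m P (χ * η)) (T (charH2 m P (χ * ξ))) =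
    lam χ * inner ℂ (charH2 m P η) (T (charH2 m P ξ))

/-- `φ ∈ L²(G)` is the symbol of `T`: its Fourier transform is `⟨T1, χ⟩` at `χ ∈ X₊` and
`⟨Tχ⁻¹, 1⟩` at `χ ∈ X₋ = X₊⁻¹ \ {1}` (written below with `χ = ξ⁻¹`). -/
def IsSymbol (T : H2 m P →L[ℂ] H2 m P) (φ : Lp ℂ 2 m) : Prop :=
  (∀ χ : P, fourierCoeff m φ χ = inner ℂ (charH2 m P χ) (T (charH2 m P 1))) ∧
  (∀ ξ : P, ξ ≠ 1 →
    fourierCoeff m φ (ξ : PontryaginDual G)⁻¹ = inner ℂ (charH2 m P 1) (T (charH2 m P ξ)))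

/-- `ψ ∈ L²(G)` is the modified symbol `φ_l` obtained from the symbol `φ` and `l ∈ G`: its Fourier
transform is `conj (χ l) * φ̂(χ)` at `χ ∈ X₊` and `φ̂(χ)` at `χ ∈ X₋ = X \ X₊`. -/
def IsModifiedSymbol (l : G) (φ ψ : Lp ℂ 2 m) : Prop :=
  (∀ χ, χ ∈ P → fourierCoeff m ψ χ = conj (χ l : ℂ) * fourierCoeff m φ χ) ∧
  (∀ χ, χ ∉ P → fourierCoeff m ψ χ = fourierCoeff m φ χ)

section RotationIndex

variable {G : Type*} [CommGroup G] [TopologicalSpace G] [IsTopologicalGroup G]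
  (P : GroupCone (PontryaginDual G))

/-- The set `X₊ \ χX₊`. -/
def gap (χ : PontryaginDual G) : Set (PontryaginDual G) :=
  (P : Set (PontryaginDual G)) \ (χ • (P : Set (PontryaginDual G)))

/-- `n` is the rotation index of the character `χ`: either `χ ∈ X₊`, the set `X₊ \ χX₊` is finite
and has `n` elements, or `χ = χ₁χ₂⁻¹` where `χ₁, χ₂ ∈ X₊` both have finite `X₊ \ χⱼX₊`, and `n` is
the difference of the cardinalities. -/
def HasCharIndex (χ : PontryaginDual G) (n : ℤ) : Prop :=
  (χ ∈ P ∧ (gap P χ).Finite ∧ n = (gap P χ).ncard) ∨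
  ∃ χ₁ ∈ P, ∃ χ₂ ∈ P, χ = χ₁ * χ₂⁻¹ ∧ (gap P χ₁).Finite ∧ (gap P χ₂).Finite ∧
    n = (gap P χ₁).ncard - (gap P χ₂).ncard

/-- The set `Xⁱ` of characters that have a rotation index. -/
def indexedChars : Set (PontryaginDual G) := {χ | ∃ n, HasCharIndex P χ n}

/-- `Φ(G) = Xⁱ exp(C(G))`. -/
def PhiSet : Set C(G, ℂ) :=
  {f | ∃ χ ∈ indexedChars P, ∃ g : C(G, ℂ), ∀ x, f x = (χ x : ℂ) * Complex.exp (g x)}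

/-- `n` is the rotation index of `f`: `f = χ exp(g)` with `g ∈ C(G)` and a character `χ` that has
rotation index `n`. -/
def HasRotationIndex (f : C(G, ℂ)) (n : ℤ) : Prop :=
  ∃ χ : PontryaginDual G, ∃ g : C(G, ℂ),
    (∀ x, f x = (χ x : ℂ) * Complex.exp (g x)) ∧ HasCharIndex P χ n

end RotationIndex

end LambdaToeplitz

end

/-!
A `λ`-Toeplitz operator is a classical Toeplitz operator followed by a unitary: comparing matrix
entries with respect to the positive characters gives `T = R T_f`, where `R` is translation by `λ`
on `H²(G)` and `T_f` is the compression to `H²(G)` of multiplication by the modified symbol `f`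
(`eq_rotH2_mul_toeplitz`). So everything is about the Fredholm theory of `T_f`, `f ∈ C(G)`.

*Invertible symbols of exponential type.* If multiplication by `a` preserves `H²(G)`, then
`T_{f a} = T_f T_a` and `T_{conj a * f} = T_a^* T_f`. Since every character or its conjugate is
positive, a trigonometric polynomial is `a + conj b` with such `a` and `b`, and
`exp g = conj (exp b) * exp r * exp a` with `r` small. All three factors give invertible operators,
so `T_{exp g}` is invertible (`isUnit_toeplitz_exp`).

*Characters.* For `χ ∈ X₊` the operator `T_χ` is an isometry and the kernel of its adjoint is
spanned by the characters in `X₊ \ χX₊` as soon as this set is finite. Hence `T_χ` is Fredholm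
exactly when `X₊ \ χX₊` is finite, with index minus its cardinality. With
`T_{χ₁ χ₂⁻¹ exp g} = T_{χ₂}^* T_{exp g} T_{χ₁}` this yields the index of `T_f` for `f ∈ Φ(G)`, and
that `χ` has an index if `T_{χ exp g}` is Fredholm (`isFredholm_toeplitz_of_hasCharIndex`,
`mem_indexedChars_of_isFredholm`).

*Fredholm implies `f = χ exp g`.* If `T_f` is Fredholm, it is bounded below up to a finite-rank
operator. The positive characters form an infinite orthonormal family, so they tend weakly to zero;
multiplying a trigonometric polynomial by them removes both the projection and the finite-rank
term. Multiplication by `f` is therefore bounded below on `L²(G)` and `f` has no zeros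
(`ne_zero_of_isFredholm_toeplitz`). On a connected group this forces `f = χ exp g`
(`exists_char_mul_exp`): the points `y` for which `f (x * y) / f x` has a continuous logarithm in
`x` form an open subgroup, hence all of `G`; writing the quotient as `c y * exp (a y x)` with `a y`
of mean zero makes `c` and `a` unique, so that `c` is a character, `y ↦ a y 1` is continuous and
`f y = f 1 * c y * exp (a y 1)`.

The density of trigonometric polynomials (`dense_span_charFun`, `dense_span_charL2`) comes from
the spectral theorem: on the orthogonal complement of the characters in `L²(G)`, an eigenspace of a
compact self-adjoint convolution operator for a nonzero eigenvalue would be a finite-dimensional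
translation-invariant space of continuous functions, and such a space contains a character.
-/

set_option linter.unusedSectionVars false
set_option linter.overlappingInstances false

namespace LambdaToeplitz

/-! ### Kernel operators -/

section Kernel

variable {X H : Type*} [TopologicalSpace X] [CompactSpace X] [NormedAddCommGroup H]
  [InnerProductSpace ℂ H]

/-- The operator `H → C(X)` with kernel `κ : C(X, H)`, sending `u` to `x ↦ ⟪κ x, u⟫`. -/
noncomputable def kernelOp (κ : C(X, H)) : H →L[ℂ] C(X, ℂ) :=
  LinearMap.mkContinuous
    { toFun u := ⟨fun x => inner ℂ (κ x) u, by fun_prop⟩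
      map_add' u v := by ext x; simp
      map_smul' c u := by ext x; simp }
    ‖κ‖ fun u => (ContinuousMap.norm_le _ (by positivity)).2 fun x =>
      (norm_inner_le_norm _ _).trans (by gcongr; exact κ.norm_coe_le_norm x)

/-- A kernel operator maps the unit ball to an equicontinuous family, so it is compact by
Arzelà–Ascoli. -/
lemma isCompactOperator_kernelOp (κ : C(X, H)) : IsCompactOperator (kernelOp κ) := by
  let e := ContinuousMap.linearIsometryBoundedOfCompact X ℂ ℂ
  let A : Set (BoundedContinuousFunction X ℂ) :=
    (fun u => e (kernelOp κ u)) '' Metric.closedBall 0 1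
  have hA : IsCompact (closure A) := by
    refine BoundedContinuousFunction.arzela_ascoli (Metric.closedBall 0 ‖κ‖)
      (isCompact_closedBall _ _) A ?_ ?_
    · rintro _ x ⟨u, hu, rfl⟩
      rw [mem_closedBall_zero_iff] at hu ⊢
      calc ‖inner ℂ (κ x) u‖ ≤ ‖κ x‖ * ‖u‖ := norm_inner_le_norm _ _
        _ ≤ ‖κ‖ * 1 := by gcongr; exact κ.norm_coe_le_norm x
        _ = ‖κ‖ := mul_one _
    · intro x₀
      rw [Metric.equicontinuousAt_iff_right]
      intro ε hε
      filter_upwards [Metric.continuousAt_iff'.1 κ.continuous.continuousAt ε hε]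
      rintro x hx ⟨_, u, hu, rfl⟩
      rw [mem_closedBall_zero_iff] at hu
      rw [dist_comm, dist_eq_norm] at *
      calc ‖inner ℂ (κ x) u - inner ℂ (κ x₀) u‖ = ‖inner ℂ (κ x - κ x₀) u‖ := by
            rw [inner_sub_left]
        _ ≤ ‖κ x - κ x₀‖ * ‖u‖ := norm_inner_le_norm _ _
        _ ≤ ‖κ x - κ x₀‖ * 1 := by gcongr
        _ < ε := by rwa [mul_one, norm_sub_rev]
  refine (isCompactOperator_iff_image_closedBall_subset_compact (kernelOp κ).toLinearMap
    one_pos).2 ⟨e.symm '' closure A, hA.image e.symm.continuous, ?_⟩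
  rintro _ ⟨u, hu, rfl⟩
  exact ⟨e (kernelOp κ u), subset_closure ⟨u, hu, rfl⟩, e.symm_apply_apply _⟩

end Kernel

/-! ### Common eigenvectors -/

/-- A commuting family of endomorphisms of a nonzero finite-dimensional complex vector space has
a common eigenvector. -/
lemma exists_common_eigenvector {ι V : Type*} [AddCommGroup V] [Module ℂ V]
    [FiniteDimensional ℂ V] [Nontrivial V] (τ : ι → Module.End ℂ V)
    (hτ : ∀ i j, Commute (τ i) (τ j)) : ∃ v : V, v ≠ 0 ∧ ∀ i, ∃ c : ℂ, τ i v = c • v := by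
  induction hn : Module.finrank ℂ V using Nat.strong_induction_on generalizing V with
  | _ n ih =>
  by_cases h : ∀ i, ∃ c : ℂ, ∀ v, τ i v = c • v
  · obtain ⟨v, hv⟩ := exists_ne (0 : V)
    exact ⟨v, hv, fun i => (h i).imp fun c hc => hc v⟩
  push Not at h
  obtain ⟨i, hi⟩ := h
  obtain ⟨c, hc⟩ := Module.End.exists_eigenvalue (τ i)
  let W := (τ i).eigenspace c
  have hW : ∀ j, ∀ w ∈ W, τ j w ∈ W := fun j w hw => by
    rw [Module.End.mem_eigenspace_iff] at hw ⊢
    have := congr($((hτ i j).eq) w)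
    simp only [Module.End.mul_apply] at this
    rw [this, hw, map_smul]
  have hlt : Module.finrank ℂ W < n := by
    rw [← hn]
    apply Submodule.finrank_lt
    intro htop
    obtain ⟨v, hv⟩ := hi c
    exact hv (Module.End.mem_eigenspace_iff.1 (show v ∈ W from htop ▸ Submodule.mem_top))
  have : Nontrivial W := Submodule.nontrivial_iff_ne_bot.2 hc
  obtain ⟨w, hw, hw'⟩ := ih _ hlt (fun j => (τ j).restrict (hW j))
    (fun j k => by
      ext w
      exact congr($((hτ j k).eq) w)) rfl
  refine ⟨w, by simpa using hw, fun j => ?_⟩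
  obtain ⟨d, hd⟩ := hw' j
  exact ⟨d, congr(($hd : V))⟩

/-! ### Translations -/

section Translation

variable {G : Type*} [CommGroup G] [TopologicalSpace G] [IsTopologicalGroup G]

/-- Translation of continuous functions: `translate z g x = g (x * z)`. -/
noncomputable def translate (z : G) : C(G, ℂ) →ₗ[ℂ] C(G, ℂ) where
  toFun g := g.comp (ContinuousMap.mulRight z)
  map_add' _ _ := rfl
  map_smul' _ _ := rfl

@[simp] lemma translate_apply (z : G) (g : C(G, ℂ)) (x : G) : translate z g x = g (x * z) := rfl

lemma charFun_apply (χ : PontryaginDual G) (x : G) : charFun χ x = χ x := rfl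

@[simp] lemma charFun_one : charFun (1 : PontryaginDual G) = 1 := rfl

lemma charFun_mul (χ ψ : PontryaginDual G) : charFun (χ * ψ) = charFun χ * charFun ψ := rfl

lemma charFun_inv (χ : PontryaginDual G) : charFun χ⁻¹ = star (charFun χ) := by
  ext x
  exact Circle.coe_inv_eq_conj (χ x)

lemma translate_charFun (z : G) (χ : PontryaginDual G) :
    translate z (charFun χ) = (χ z : ℂ) • charFun χ := by
  ext x
  simp [charFun, mul_comm]

/-- A continuous multiplicative function from a compact group to `ℂ` with value `1` at `1` is a
character: its powers are bounded, so it is unimodular. -/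
lemma exists_char_of_map_mul [CompactSpace G] (c : C(G, ℂ)) (h1 : c 1 = 1)
    (hmul : ∀ x y, c (x * y) = c x * c y) : ∃ χ : PontryaginDual G, ∀ x, (χ x : ℂ) = c x := by
  have hpow (x : G) (n : ℕ) : c (x ^ n) = c x ^ n := by
    induction n with
    | zero => simp [h1]
    | succ n ih => rw [pow_succ, pow_succ, hmul, ih]
  have hle (x : G) : ‖c x‖ ≤ 1 := by
    by_contra! hx
    obtain ⟨n, hn⟩ := pow_unbounded_of_one_lt ‖c‖ hx
    have := c.norm_coe_le_norm (x ^ n)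
    rw [hpow, norm_pow] at this
    linarith
  have hnorm (x : G) : ‖c x‖ = 1 := by
    refine le_antisymm (hle x) ?_
    have h : ‖c x‖ * ‖c x⁻¹‖ = 1 := by rw [← norm_mul, ← hmul, mul_inv_cancel, h1, norm_one]
    nlinarith [hle x⁻¹, norm_nonneg (c x)]
  let F : G →ₜ* Circle :=
    { toFun x := ⟨c x, mem_sphere_zero_iff_norm.2 (hnorm x)⟩
      map_one' := Circle.ext h1
      map_mul' x y := Circle.ext (hmul x y)
      continuous_toFun := by fun_prop }
  exact ⟨F, fun x => rfl⟩

/-- A common eigenvector of all translations is a multiple of a character. -/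
lemma exists_char_of_translate_eq_smul [CompactSpace G] (g : C(G, ℂ)) (hg : g ≠ 0)
    (h : ∀ z, ∃ c : ℂ, translate z g = c • g) :
    ∃ χ : PontryaginDual G, ∃ a : ℂ, a ≠ 0 ∧ g = a • charFun χ := by
  choose c hc using h
  have hc' (z x : G) : g (x * z) = c z * g x := congr($(hc z) x)
  have h1 : g 1 ≠ 0 := fun h0 => hg <| by
    ext x
    simpa [h0] using hc' x 1
  have hcz (z : G) : c z = g z / g 1 := by
    rw [eq_div_iff h1, ← hc', one_mul]
  obtain ⟨χ, hχ⟩ := exists_char_of_map_mul ⟨fun z => g z / g 1, by fun_prop⟩ (div_self h1)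
    (fun x y => by
      simp only [ContinuousMap.coe_mk]
      rw [hc', hcz]
      ring)
  refine ⟨χ, g 1, h1, ?_⟩
  ext x
  simp only [ContinuousMap.coe_mk] at hχ
  simp [charFun, hχ, mul_div_cancel₀ _ h1]

end Translation

/-! ### Completeness of the characters -/

section Completeness

variable {G : Type*} [CommGroup G] [TopologicalSpace G] [IsTopologicalGroup G] [CompactSpace G]
  [MeasurableSpace G] [BorelSpace G] (m : Measure G) [m.IsHaarMeasure] [IsProbabilityMeasure m]

lemma orthonormal_charL2 : Orthonormal ℂ (charL2 m : PontryaginDual G → Lp ℂ 2 m) := by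
  classical
  rw [orthonormal_iff_ite]
  intro χ ψ
  split_ifs with h
  · subst h
    rw [charL2, ContinuousMap.inner_toLp]
    have : ∀ x, charFun χ x * conj (charFun χ x) = 1 := fun x => by
      simp [charFun, Complex.mul_conj]
    simp [this]
  · rw [← fourierCoeff_eq_inner, fourierCoeff_charL2_of_ne m ψ χ (Ne.symm h)]

lemma inner_toLp_translate (z : G) (g h : C(G, ℂ)) :
    inner ℂ (ContinuousMap.toLp 2 m ℂ h) (ContinuousMap.toLp 2 m ℂ (translate z g)) =
      inner ℂ (ContinuousMap.toLp 2 m ℂ (translate z⁻¹ h)) (ContinuousMap.toLp 2 m ℂ g) := by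
  rw [ContinuousMap.inner_toLp, ContinuousMap.inner_toLp,
    ← integral_mul_right_eq_self (μ := m) (fun x => g x * conj (translate z⁻¹ h x)) z]
  simp

/-- The kernel of the convolution operator with `k`: the point `x` is sent to the translate
`y ↦ k (y * x⁻¹)`, as an element of `L²(G)`. -/
noncomputable def convKernel (k : C(G, ℂ)) : C(G, Lp ℂ 2 m) where
  toFun x := ContinuousMap.toLp 2 m ℂ (translate x⁻¹ k)
  continuous_toFun := by
    let F : C(G × G, ℂ) := ⟨fun p => k (p.2 * p.1⁻¹), by fun_prop⟩
    exact (ContinuousMap.toLp 2 m ℂ).continuous.comp F.curry.continuous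

/-- The convolution operator `L²(G) → C(G)`, `u ↦ (x ↦ ∫ u y * conj (k (y * x⁻¹)))`. -/
noncomputable def conv (k : C(G, ℂ)) : Lp ℂ 2 m →L[ℂ] C(G, ℂ) := kernelOp (convKernel m k)

lemma conv_apply (k : C(G, ℂ)) (u : Lp ℂ 2 m) (x : G) :
    conv m k u x = inner ℂ (ContinuousMap.toLp 2 m ℂ (translate x⁻¹ k)) u := rfl

lemma conv_translate (k : C(G, ℂ)) (z : G) (g : C(G, ℂ)) :
    conv m k (ContinuousMap.toLp 2 m ℂ (translate z g)) =
      translate z (conv m k (ContinuousMap.toLp 2 m ℂ g)) := by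
  ext x
  rw [translate_apply, conv_apply, conv_apply, inner_toLp_translate]
  have h : translate z⁻¹ (translate x⁻¹ k) = translate (x * z)⁻¹ k := by
    ext y
    simp [mul_assoc]
  rw [h]

/-- The convolution operator on `L²(G)`. -/
noncomputable def convL2 (k : C(G, ℂ)) : Lp ℂ 2 m →L[ℂ] Lp ℂ 2 m :=
  ContinuousMap.toLp 2 m ℂ ∘L conv m k

lemma convL2_apply (k : C(G, ℂ)) (u : Lp ℂ 2 m) :
    convL2 m k u = ContinuousMap.toLp 2 m ℂ (conv m k u) := rfl

lemma isCompactOperator_convL2 (k : C(G, ℂ)) : IsCompactOperator (convL2 m k) :=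
  (isCompactOperator_kernelOp (convKernel m k)).clm_comp (ContinuousMap.toLp 2 m ℂ)

lemma convL2_charL2 (k : C(G, ℂ)) (χ : PontryaginDual G) :
    convL2 m k (charL2 m χ) = conv m k (charL2 m χ) 1 • charL2 m χ := by
  rw [convL2_apply, charL2, ← map_smul]
  congr 1
  ext z
  have h := conv_translate m k z (charFun χ)
  rw [translate_charFun, map_smul, map_smul] at h
  have := congr($h 1)
  simp only [ContinuousMap.smul_apply, translate_apply, one_mul] at this
  rw [← this]
  simp [charFun, mul_comm]

variable [T2Space G] [m.Regular]

lemma denseRange_toLp : DenseRange (ContinuousMap.toLp 2 m ℂ : C(G, ℂ) → Lp ℂ 2 m) :=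
  ContinuousMap.toLp_denseRange ℂ m ℂ (by simp)

lemma isSymmetric_convL2 (k : C(G, ℂ)) (hk : ∀ y, k y⁻¹ = conj (k y)) :
    (convL2 m k).IsSymmetric := by
  intro u v
  refine (denseRange_toLp m).induction_on₂
    (p := fun u v => inner ℂ (convL2 m k u) v = inner ℂ u (convL2 m k v))
    (isClosed_eq (by fun_prop) (by fun_prop)) (fun g h => ?_) u v
  simp only [convL2_apply, ContinuousMap.inner_toLp]
  have key (g : C(G, ℂ)) (x : G) : conv m k (ContinuousMap.toLp 2 m ℂ g) x =
      ∫ y, g y * conj (k (y * x⁻¹)) ∂m := by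
    rw [conv_apply, ContinuousMap.inner_toLp]
    rfl
  simp_rw [key, ← integral_conj, ← integral_const_mul, ← integral_mul_const]
  rw [integral_integral_swap_of_hasCompactSupport
    (by simp only [Function.uncurry_def]; fun_prop) (HasCompactSupport.of_compactSpace _)]
  congr! 4 with y x
  simp only [map_mul, Complex.conj_conj]
  rw [← hk, mul_inv, inv_inv, mul_comm y]
  ring

/-- The closed span of the characters has no room for a compact self-adjoint convolution operator:
such an operator vanishes on its orthogonal complement. Otherwise the complement contains an
eigenspace for a nonzero eigenvalue; this is a finite-dimensional space of continuous functions
invariant under translations, so it contains a character. -/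
lemma convL2_eq_zero_of_mem_orthogonal (k : C(G, ℂ)) (hk : ∀ y, k y⁻¹ = conj (k y))
    (u : Lp ℂ 2 m) (hu : u ∈ (Submodule.span ℂ (Set.range (charL2 m)))ᗮ) : convL2 m k u = 0 := by
  set N := Submodule.span ℂ (Set.range (charL2 m))
  have hN : ∀ n ∈ N, convL2 m k n ∈ N := by
    intro n hn
    induction hn using Submodule.span_induction with
    | mem x hx =>
      obtain ⟨χ, rfl⟩ := hx
      rw [convL2_charL2]
      exact N.smul_mem _ (Submodule.subset_span ⟨χ, rfl⟩)
    | zero => simp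
    | add x y _ _ hx hy => rw [map_add]; exact N.add_mem hx hy
    | smul c x _ hx => rw [map_smul]; exact N.smul_mem _ hx
  have hNo : ∀ v ∈ Nᗮ, convL2 m k v ∈ Nᗮ := fun v hv n hn => by
    have h := isSymmetric_convL2 m k hk n v
    exact h.symm.trans (hv _ (hN n hn))
  let S : Nᗮ →L[ℂ] Nᗮ := (convL2 m k).restrict hNo
  have hSc : IsCompactOperator S := (isCompactOperator_convL2 m k).restrict' hNo
  have hSs : S.IsSymmetric := (isSymmetric_convL2 m k hk).restrict_invariant hNo
  suffices hS : S = 0 from congr((($hS ⟨u, hu⟩ : Nᗮ) : Lp ℂ 2 m))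
  refine (ContinuousLinearMap.eq_zero_of_forall_hasEigenvalue_eq_zero hSc hSs).1 fun μ hμ => ?_
  by_contra hμ0
  have := ContinuousLinearMap.finite_dimensional_eigenspace (T := S) hSc μ hμ0
  -- eigenvectors for `μ ≠ 0` are continuous, because convolutions are; `V` is the eigenspace,
  -- realized inside `C(G)`
  let V : Submodule ℂ C(G, ℂ) :=
    LinearMap.ker ((conv m k ∘L ContinuousMap.toLp 2 m ℂ).toLinearMap - μ • LinearMap.id) ⊓
      Nᗮ.comap (ContinuousMap.toLp 2 m ℂ).toLinearMap
  have hV (g : C(G, ℂ)) : g ∈ V ↔ conv m k (ContinuousMap.toLp 2 m ℂ g) = μ • g ∧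
      ContinuousMap.toLp 2 m ℂ g ∈ Nᗮ := by
    simp [V, sub_eq_zero]
  let ι : V →ₗ[ℂ] Module.End.eigenspace (S : Module.End ℂ Nᗮ) μ :=
    LinearMap.codRestrict _ (LinearMap.codRestrict Nᗮ
      ((ContinuousMap.toLp 2 m ℂ).toLinearMap ∘ₗ V.subtype) fun g => ((hV g).1 g.2).2) fun g => by
        rw [Module.End.mem_eigenspace_iff]
        ext1
        change ContinuousMap.toLp 2 m ℂ (conv m k (ContinuousMap.toLp 2 m ℂ g)) = _
        rw [((hV g).1 g.2).1, map_smul]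
        rfl
  have hι : Function.Injective ι := fun g h hgh => Subtype.ext <|
    ContinuousMap.toLp_injective (p := 2) (𝕜 := ℂ) m congr((($hgh : Nᗮ) : Lp ℂ 2 m))
  have : FiniteDimensional ℂ V := FiniteDimensional.of_injective ι hι
  obtain ⟨w, hw, hw0⟩ := hμ.exists_hasEigenvector
  rw [Module.End.mem_eigenspace_iff] at hw
  have hw' : ContinuousMap.toLp 2 m ℂ (conv m k w) = μ • (w : Lp ℂ 2 m) := congr(($hw : Lp ℂ 2 m))
  have hgw : ContinuousMap.toLp 2 m ℂ (μ⁻¹ • conv m k w) = w := by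
    rw [map_smul, hw', smul_smul, inv_mul_cancel₀ hμ0, one_smul]
  have hgV : μ⁻¹ • conv m k w ∈ V := by
    rw [hV, hgw, smul_smul, mul_inv_cancel₀ hμ0, one_smul]
    exact ⟨rfl, w.2⟩
  have : Nontrivial V := by
    refine ⟨⟨⟨_, hgV⟩, 0, fun h0 => hw0 ?_⟩⟩
    have h0' : μ⁻¹ • conv m k w = 0 := congr(($h0 : C(G, ℂ)))
    ext1
    rw [← hgw, h0', map_zero]
    rfl
  have hτ (z : G) : ∀ g ∈ V, translate z g ∈ V := fun g hg => by
    rw [hV] at hg ⊢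
    refine ⟨by rw [conv_translate, hg.1, map_smul], ?_⟩
    rw [Submodule.mem_orthogonal]
    intro n hn
    induction hn using Submodule.span_induction with
    | mem x hx =>
      obtain ⟨χ, rfl⟩ := hx
      rw [charL2, inner_toLp_translate, translate_charFun, map_smul, inner_smul_left]
      exact mul_eq_zero_of_right _ (hg.2 _ (Submodule.subset_span ⟨χ, rfl⟩))
    | zero => simp
    | add x y _ _ hx hy => rw [inner_add_left, hx, hy, add_zero]
    | smul c x _ hx => rw [inner_smul_left, hx, mul_zero]
  obtain ⟨v, hv0, hv⟩ := exists_common_eigenvector (fun z : G => (translate z).restrict (hτ z))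
    (fun y z => by
      ext v x
      change (v : C(G, ℂ)) (x * y * z) = (v : C(G, ℂ)) (x * z * y)
      rw [mul_right_comm])
  obtain ⟨χ, a, ha, hχ⟩ := exists_char_of_translate_eq_smul (v : C(G, ℂ)) (by simpa using hv0)
    fun z => by
      obtain ⟨c, hc⟩ := hv z
      exact ⟨c, congrArg Subtype.val hc⟩
  have h1 := ((hV v).1 v.2).2 (charL2 m χ) (Submodule.subset_span ⟨χ, rfl⟩)
  rw [hχ, map_smul, inner_smul_right] at h1
  refine ha ((mul_eq_zero.1 h1).resolve_right ?_)
  change inner ℂ (charL2 m χ) (charL2 m χ) ≠ 0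
  rw [inner_self_ne_zero]
  exact (orthonormal_charL2 m).ne_zero χ

/-- The Peter–Weyl theorem for compact abelian groups: the characters are complete in `L²(G)`. -/
theorem orthogonal_span_charL2 : (Submodule.span ℂ (Set.range (charL2 m)))ᗮ = ⊥ := by
  rw [Submodule.eq_bot_iff]
  intro u hu
  have h1 (k : C(G, ℂ)) (hk : ∀ y, k y⁻¹ = conj (k y)) :
      inner ℂ (ContinuousMap.toLp 2 m ℂ k) u = 0 := by
    have h := convL2_eq_zero_of_mem_orthogonal m k hk u hu
    rw [convL2_apply, ← map_zero (ContinuousMap.toLp 2 m ℂ)] at h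
    have h' := congr($(ContinuousMap.toLp_injective (p := 2) (𝕜 := ℂ) m h) 1)
    have h1 : translate 1⁻¹ k = k := by
      ext y
      simp
    rwa [conv_apply, h1] at h'
  have h2 (h : C(G, ℂ)) : inner ℂ (ContinuousMap.toLp 2 m ℂ h) u = 0 := by
    -- `h` is a combination of two Hermitian functions
    let h' : C(G, ℂ) := ⟨fun y => conj (h y⁻¹), by fun_prop⟩
    have e : h = (1 / 2 : ℂ) • (h + h') + (-Complex.I / 2) • (Complex.I • (h - h')) := by
      ext y
      simp only [ContinuousMap.add_apply, ContinuousMap.smul_apply, ContinuousMap.sub_apply,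
        smul_eq_mul]
      linear_combination ((h y - h' y) / 2) * Complex.I_sq
    rw [e, map_add, map_smul, map_smul, inner_add_left, inner_smul_left, inner_smul_left,
      h1 (h + h') (fun y => by simp [h', add_comm]),
      h1 (Complex.I • (h - h')) (fun y => by simp [h']; ring)]
    simp
  refine (denseRange_toLp m).induction_on (p := fun v => inner ℂ v u = 0) u
    (isClosed_eq (by fun_prop) (by fun_prop)) h2 |> inner_self_eq_zero.1

lemma eq_zero_of_forall_inner_charL2 (u : Lp ℂ 2 m) (h : ∀ χ, inner ℂ (charL2 m χ) u = 0) :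
    u = 0 := by
  have hu : u ∈ (Submodule.span ℂ (Set.range (charL2 m)))ᗮ := by
    rw [Submodule.mem_orthogonal]
    intro n hn
    induction hn using Submodule.span_induction with
    | mem x hx => obtain ⟨χ, rfl⟩ := hx; exact h χ
    | zero => simp
    | add x y _ _ hx hy => rw [inner_add_left, hx, hy, add_zero]
    | smul c x _ hx => rw [inner_smul_left, hx, mul_zero]
  rwa [orthogonal_span_charL2, Submodule.mem_bot] at hu

lemma dense_span_charL2 :
    Dense (Submodule.span ℂ (Set.range (charL2 m)) : Set (Lp ℂ 2 m)) := by
  rw [Submodule.dense_iff_topologicalClosure_eq_top,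
    Submodule.topologicalClosure_eq_top_iff, orthogonal_span_charL2]

/-- The characters of a compact abelian group separate its points. -/
theorem exists_char_ne (m : Measure G) [m.IsHaarMeasure] [IsProbabilityMeasure m] [m.Regular]
    {x y : G} (hxy : x ≠ y) : ∃ χ : PontryaginDual G, χ x ≠ χ y := by
  by_contra! h
  -- translation by `y⁻¹ * x` preserves Fourier coefficients, hence every continuous function
  have key (g : C(G, ℂ)) : translate (y⁻¹ * x) g = g := by
    refine ContinuousMap.toLp_injective (p := 2) (𝕜 := ℂ) m (sub_eq_zero.1 ?_)
    refine eq_zero_of_forall_inner_charL2 m _ fun χ => ?_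
    rw [inner_sub_right, charL2, inner_toLp_translate, translate_charFun]
    simp [h χ]
  obtain ⟨f, hfy, hfx, -⟩ := exists_continuous_zero_one_of_isClosed (isClosed_singleton (x := y))
    (isClosed_singleton (x := x)) (by simpa using hxy.symm)
  have := congr($(key ⟨fun z => (f z : ℂ), by fun_prop⟩) y)
  simp [hfy rfl, hfx rfl] at this

/-- Trigonometric polynomials are uniformly dense in `C(G)`. -/
theorem dense_span_charFun (m : Measure G) [m.IsHaarMeasure] [IsProbabilityMeasure m]
    [m.Regular] :
    Dense (Submodule.span ℂ (Set.range (charFun (G := G))) : Set C(G, ℂ)) := by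
  let A : StarSubalgebra ℂ C(G, ℂ) :=
    { toSubalgebra := Algebra.adjoin ℂ (Set.range charFun)
      star_mem' := by
        change Algebra.adjoin ℂ (Set.range charFun) ≤ star (Algebra.adjoin ℂ (Set.range charFun))
        refine Algebra.adjoin_le ?_
        rintro - ⟨χ, rfl⟩
        exact Algebra.subset_adjoin ⟨χ⁻¹, charFun_inv χ⟩ }
  have hA : Subalgebra.toSubmodule A.toSubalgebra = Submodule.span ℂ (Set.range charFun) := by
    refine Algebra.adjoin_eq_span_of_subset _ (subset_trans ?_ Submodule.subset_span)
    intro x hx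
    refine Submonoid.closure_induction (fun _ => id) ⟨1, rfl⟩ ?_ hx
    rintro - - - - ⟨χ, rfl⟩ ⟨ψ, rfl⟩
    exact ⟨χ * ψ, rfl⟩
  have hsep : A.SeparatesPoints := fun x y hxy => by
    obtain ⟨χ, hχ⟩ := exists_char_ne m hxy
    exact ⟨_, ⟨charFun χ, Algebra.subset_adjoin ⟨χ, rfl⟩, rfl⟩, fun h => hχ (Circle.ext h)⟩
  rw [Submodule.dense_iff_topologicalClosure_eq_top, ← hA]
  exact congr_arg (Subalgebra.toSubmodule <| StarSubalgebra.toSubalgebra ·)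
    (ContinuousMap.starSubalgebra_topologicalClosure_eq_top_of_separatesPoints A hsep)

end Completeness

/-! ### Continuous functions without zeros on a connected group -/

section Logarithm

variable {G : Type*} [CommGroup G] [TopologicalSpace G] [IsTopologicalGroup G] [CompactSpace G]
  [MeasurableSpace G] [BorelSpace G] (m : Measure G) [m.IsHaarMeasure] [IsProbabilityMeasure m]

lemma eq_of_exp_const {X : Type*} [TopologicalSpace X] [PreconnectedSpace X] (a : C(X, ℂ)) (d : ℂ)
    (h : ∀ x, Complex.exp (a x) = d) (x y : X) : a x = a y := by
  have key : {z | a z = a y} = {z | ‖a z - a y‖ < 1} := by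
    ext z
    refine ⟨fun hz => by simp [show a z = a y from hz], fun hz => ?_⟩
    have h1 : Complex.exp (a z - a y) = 1 := by
      rw [Complex.exp_sub, h, h, div_self (by rw [← h y]; exact Complex.exp_ne_zero _)]
    obtain ⟨n, hn⟩ := Complex.exp_eq_one_iff.1 h1
    have hz' : ‖a z - a y‖ < 1 := hz
    rw [hn, norm_mul] at hz'
    have h2π : ‖(2 * Real.pi * Complex.I : ℂ)‖ = 2 * Real.pi := by
      simp [abs_of_pos Real.pi_pos]
    rw [h2π, Complex.norm_intCast] at hz'
    have hn1 : |(n : ℝ)| < 1 := by nlinarith [Real.pi_gt_three, abs_nonneg (n : ℝ)]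
    have hn0 : n = 0 := by
      rw [← Int.abs_lt_one_iff]
      exact_mod_cast hn1
    rw [hn0] at hn
    simpa [sub_eq_zero] using hn
  have hclopen : IsClopen {z | a z = a y} := by
    refine ⟨isClosed_eq (by fun_prop) (by fun_prop), ?_⟩
    rw [key]
    exact isOpen_lt (by fun_prop) (by fun_prop)
  have := hclopen.eq_univ ⟨y, rfl⟩
  exact (this ▸ Set.mem_univ x : x ∈ {z | a z = a y})

/-- The increment `f (x * y) / f x` equals `c * exp (a x)` for a function `a` of mean zero. -/
def HasIncrement (f : C(G, ℂ)) (y : G) (a : C(G, ℂ)) (c : ℂ) : Prop :=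
  ∫ x, a x ∂m = 0 ∧ ∀ x, f (x * y) = f x * c * Complex.exp (a x)

variable {m} {f : C(G, ℂ)}

lemma integrable_continuousMap (a : C(G, ℂ)) : Integrable a m :=
  a.continuous.integrable_of_hasCompactSupport (HasCompactSupport.of_compactSpace _)

lemma HasIncrement.unique [PreconnectedSpace G] (hf : ∀ x, f x ≠ 0) {y : G} {a b : C(G, ℂ)}
    {c d : ℂ} (ha : HasIncrement m f y a c) (hb : HasIncrement m f y b d) : a = b ∧ c = d := by
  have hc : c ≠ 0 := by
    rintro rfl
    exact hf _ (by simpa using ha.2 1)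
  have h1 (x : G) : Complex.exp ((a - b) x) = d / c := by
    have := ha.2 x
    rw [hb.2 x] at this
    rw [ContinuousMap.sub_apply, Complex.exp_sub, div_eq_div_iff (Complex.exp_ne_zero _) hc]
    refine mul_left_cancel₀ (hf x) ?_
    linear_combination -this
  have h2 := eq_of_exp_const (a - b) _ h1
  have h3 : ∫ x, (a - b) x ∂m = 0 := by
    simp only [ContinuousMap.sub_apply]
    rw [integral_sub (integrable_continuousMap a) (integrable_continuousMap b), ha.1, hb.1,
      sub_zero]
  have h4 (x : G) : (a - b) x = 0 := by
    simp_rw [h2 _ x] at h3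
    simpa using h3
  have hab : a = b := by
    ext x
    exact sub_eq_zero.1 (h4 x)
  refine ⟨hab, ?_⟩
  have := h1 1
  rw [h4, Complex.exp_zero, eq_div_iff hc, one_mul] at this
  exact this

lemma HasIncrement.mul {y z : G} {a b : C(G, ℂ)} {c d : ℂ} (ha : HasIncrement m f y a c)
    (hb : HasIncrement m f z b d) : HasIncrement m f (y * z) (a + translate y b) (c * d) := by
  refine ⟨?_, fun x => ?_⟩
  · simp only [ContinuousMap.add_apply]
    rw [integral_add (integrable_continuousMap a) (integrable_continuousMap _), ha.1, zero_add]
    simp only [translate_apply]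
    rw [integral_mul_right_eq_self (μ := m) (fun x => b x), hb.1]
  · rw [← mul_assoc, hb.2, ha.2, ContinuousMap.add_apply, Complex.exp_add, translate_apply]
    ring

lemma HasIncrement.inv (hf : ∀ x, f x ≠ 0) {y : G} {a : C(G, ℂ)} {c : ℂ}
    (ha : HasIncrement m f y a c) : HasIncrement m f y⁻¹ (-translate y⁻¹ a) c⁻¹ := by
  have hc : c ≠ 0 := by
    rintro rfl
    exact hf _ (by simpa using ha.2 1)
  refine ⟨?_, fun x => ?_⟩
  · simp only [ContinuousMap.neg_apply, translate_apply]
    rw [integral_neg, integral_mul_right_eq_self (μ := m) (fun x => a x), ha.1, neg_zero]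
  · have := ha.2 (x * y⁻¹)
    rw [inv_mul_cancel_right] at this
    rw [this, ContinuousMap.neg_apply, Complex.exp_neg, translate_apply]
    field_simp [Complex.exp_ne_zero]

lemma hasIncrement_one : HasIncrement m f 1 0 1 := by
  simp [HasIncrement]

/-- Near the identity, increments are close to `1` and have small logarithms. -/
lemma eventually_hasIncrement (m : Measure G) [m.IsHaarMeasure] [IsProbabilityMeasure m]
    (hf : ∀ x, f x ≠ 0) {ε : ℝ} (hε : 0 < ε) :
    ∀ᶠ y in nhds (1 : G), ∃ a c, HasIncrement m f y a c ∧ ‖a‖ ≤ ε := by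
  let F : C(G × G, ℂ) :=
    ⟨fun p => f (p.2 * p.1) / f p.2, by fun_prop (disch := exact fun _ => hf _)⟩
  have hF1 : F.curry 1 = 1 := by
    ext x
    simp [F, hf]
  have hδ : 0 < min (1 / 2) (ε / 3) := by positivity
  have := F.curry.continuous.continuousAt (x := 1) (Metric.ball_mem_nhds _ hδ)
  filter_upwards [this] with y hy
  rw [Set.mem_preimage, hF1, mem_ball_iff_norm] at hy
  have hx (x : G) : ‖f (x * y) / f x - 1‖ < min (1 / 2) (ε / 3) :=
    ((F.curry y - 1).norm_coe_le_norm x).trans_lt hy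
  have hs (x : G) : f (x * y) / f x ∈ Complex.slitPlane := by
    have h := Complex.mem_slitPlane_of_norm_lt_one (z := f (x * y) / f x - 1)
      ((hx x).trans_le ((min_le_left _ _).trans (by norm_num)))
    simpa using h
  let L : C(G, ℂ) := ⟨fun x => Complex.log (f (x * y) / f x),
    Continuous.clog (by fun_prop (disch := exact fun _ => hf _)) hs⟩
  have hL : ‖L‖ ≤ ε / 2 := by
    refine (ContinuousMap.norm_le _ (by positivity)).2 fun x => ?_
    have h1 := Complex.norm_log_one_add_half_le_self (z := f (x * y) / f x - 1)
      ((hx x).le.trans (min_le_left _ _))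
    rw [add_sub_cancel] at h1
    have h2 := (hx x).le.trans (min_le_right _ _)
    change ‖Complex.log (f (x * y) / f x)‖ ≤ _
    linarith
  have hint : ‖∫ x, L x ∂m‖ ≤ ε / 2 := by
    have := norm_integral_le_of_norm_le_const (μ := m) (f := L) (C := ε / 2)
      (Filter.Eventually.of_forall fun x => (L.norm_coe_le_norm x).trans hL)
    simpa using this
  refine ⟨L - ContinuousMap.const G (∫ x, L x ∂m), Complex.exp (∫ x, L x ∂m), ⟨?_, fun x => ?_⟩, ?_⟩
  · simp only [ContinuousMap.sub_apply, ContinuousMap.const_apply]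
    rw [integral_sub (integrable_continuousMap L) (integrable_const _)]
    simp
  · rw [ContinuousMap.sub_apply, ContinuousMap.const_apply, mul_assoc, ← Complex.exp_add,
      add_sub_cancel]
    change _ = f x * Complex.exp (Complex.log (f (x * y) / f x))
    rw [Complex.exp_log (div_ne_zero (hf _) (hf _)), mul_div_cancel₀ _ (hf x)]
  · refine (ContinuousMap.norm_le _ hε.le).2 fun x => ?_
    calc ‖L x - ∫ x, L x ∂m‖ ≤ ‖L x‖ + ‖∫ x, L x ∂m‖ := norm_sub_le _ _
      _ ≤ ε / 2 + ε / 2 := add_le_add ((L.norm_coe_le_norm x).trans hL) hint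
      _ = ε := add_halves ε

lemma exists_hasIncrement [PreconnectedSpace G] (hf : ∀ x, f x ≠ 0) (y : G) :
    ∃ a c, HasIncrement m f y a c := by
  let K : Subgroup G :=
    { carrier := {y | ∃ a c, HasIncrement m f y a c}
      mul_mem' := fun ⟨a, c, h⟩ ⟨b, d, h'⟩ => ⟨_, _, h.mul h'⟩
      one_mem' := ⟨_, _, hasIncrement_one⟩
      inv_mem' := fun ⟨a, c, h⟩ => ⟨_, _, h.inv hf⟩ }
  have hK : IsOpen (K : Set G) := K.isOpen_of_mem_nhds (g := 1) <|
    (eventually_hasIncrement m hf one_pos).mono fun y ⟨a, c, h, _⟩ => ⟨a, c, h⟩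
  have := IsClopen.eq_univ ⟨K.isClosed_of_isOpen hK, hK⟩ ⟨1, K.one_mem⟩
  exact (this ▸ Set.mem_univ y : y ∈ (K : Set G))

/-- The Bohr–van Kampen theorem: a continuous function without zeros on a compact connected
abelian group is the product of a character and an exponential. -/
theorem exists_char_mul_exp [PreconnectedSpace G] (m : Measure G) [m.IsHaarMeasure]
    [IsProbabilityMeasure m] (f : C(G, ℂ)) (hf : ∀ x, f x ≠ 0) :
    ∃ χ : PontryaginDual G, ∃ g : C(G, ℂ), ∀ x, f x = χ x * Complex.exp (g x) := by
  choose a c h using exists_hasIncrement (m := m) hf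
  have hmul (y z : G) : a (y * z) = a y + translate y (a z) ∧ c (y * z) = c y * c z :=
    (h (y * z)).unique hf ((h y).mul (h z))
  have h1 := (h 1).unique hf hasIncrement_one
  -- by the cocycle identity continuity is only needed at the identity, where logarithms are small
  have hcont : Continuous fun y => a y 1 := by
    rw [continuous_iff_continuousAt]
    intro y
    rw [Metric.continuousAt_iff']
    intro ε hε
    have hy : Filter.Tendsto (fun z => y⁻¹ * z) (nhds y) (nhds 1) := by
      have : Continuous fun z => y⁻¹ * z := by fun_prop
      simpa using this.tendsto y
    filter_upwards [hy (eventually_hasIncrement m hf (half_pos hε))] with z ⟨b, d, hb, hbε⟩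
    obtain ⟨rfl, rfl⟩ := hb.unique hf (h _)
    have h2 := (hmul y (y⁻¹ * z)).1
    rw [mul_inv_cancel_left] at h2
    rw [h2, dist_eq_norm, ContinuousMap.add_apply, add_sub_cancel_left, translate_apply]
    exact ((ContinuousMap.norm_coe_le_norm _ _).trans hbε).trans_lt (half_lt_self hε)
  have hf1 (y : G) : f y = f 1 * c y * Complex.exp (a y 1) := by
    simpa using (h y).2 1
  have hc : Continuous c := by
    have : c = fun y => f y / (f 1 * Complex.exp (a y 1)) := by
      ext y
      rw [eq_div_iff (mul_ne_zero (hf 1) (Complex.exp_ne_zero _)), hf1 y]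
      ring
    rw [this]
    exact f.continuous.div (by fun_prop) fun y => mul_ne_zero (hf 1) (Complex.exp_ne_zero _)
  obtain ⟨χ, hχ⟩ := exists_char_of_map_mul ⟨c, hc⟩ h1.2 fun x y => (hmul x y).2
  refine ⟨χ, ⟨fun y => Complex.log (f 1) + a y 1, by fun_prop⟩, fun y => ?_⟩
  rw [hχ, hf1 y]
  simp only [ContinuousMap.coe_mk]
  rw [Complex.exp_add, Complex.exp_log (hf 1)]
  ring

end Logarithm

/-! ### Multiplication operators -/

section Multiplication

variable {G : Type*} [CommGroup G] [TopologicalSpace G] [IsTopologicalGroup G] [CompactSpace G]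
  [MeasurableSpace G] [BorelSpace G] (m : Measure G) [m.IsHaarMeasure] [IsProbabilityMeasure m]

/-- Multiplication by a continuous function, as a bounded operator on `L²(G)`. -/
noncomputable def mulOp : C(G, ℂ) →L[ℂ] Lp ℂ 2 m →L[ℂ] Lp ℂ 2 m :=
  (ContinuousLinearMap.mul ℂ ℂ).holderL m ⊤ 2 2 ∘L ContinuousMap.toLp ⊤ m ℂ

lemma coeFn_mulOp (f : C(G, ℂ)) (u : Lp ℂ 2 m) : mulOp m f u =ᵐ[m] fun x => f x * u x := by
  have h := (ContinuousLinearMap.mul ℂ ℂ).coeFn_holder (r := 2) (ContinuousMap.toLp ⊤ m ℂ f) u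
  filter_upwards [h, ContinuousMap.coeFn_toLp (p := ⊤) (𝕜 := ℂ) m f] with x hx hx'
  rw [hx'] at hx
  exact hx

lemma mulOp_toLp (f g : C(G, ℂ)) :
    mulOp m f (ContinuousMap.toLp 2 m ℂ g) = ContinuousMap.toLp 2 m ℂ (f * g) := by
  apply Lp.ext
  filter_upwards [coeFn_mulOp m f (ContinuousMap.toLp 2 m ℂ g),
    ContinuousMap.coeFn_toLp (p := 2) (𝕜 := ℂ) m g,
    ContinuousMap.coeFn_toLp (p := 2) (𝕜 := ℂ) m (f * g)] with x h1 h2 h3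
  rw [h1, h2, h3, ContinuousMap.mul_apply]

lemma mulOp_one : mulOp m 1 = 1 := by
  ext1 u
  apply Lp.ext
  filter_upwards [coeFn_mulOp m 1 u] with x h1
  rw [h1]
  simp

lemma mulOp_mul (f g : C(G, ℂ)) : mulOp m (f * g) = mulOp m f * mulOp m g := by
  ext1 u
  apply Lp.ext
  rw [mul_apply_eq_comp]
  filter_upwards [coeFn_mulOp m (f * g) u, coeFn_mulOp m f (mulOp m g u), coeFn_mulOp m g u]
    with x h1 h2 h3
  rw [h1, h2, h3, ContinuousMap.mul_apply, mul_assoc]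

lemma inner_mulOp (f : C(G, ℂ)) (u v : Lp ℂ 2 m) :
    inner ℂ (mulOp m f u) v = inner ℂ u (mulOp m (star f) v) := by
  rw [L2.inner_def, L2.inner_def]
  apply integral_congr_ae
  filter_upwards [coeFn_mulOp m f u, coeFn_mulOp m (star f) v] with x h1 h2
  rw [h1, h2]
  simp only [RCLike.inner_apply, map_mul, ContinuousMap.star_apply, RCLike.star_def]
  ring

lemma norm_mulOp_le (f : C(G, ℂ)) (u : Lp ℂ 2 m) : ‖mulOp m f u‖ ≤ ‖f‖ * ‖u‖ := by
  refine Lp.norm_le_mul_norm_of_ae_le_mul ?_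
  filter_upwards [coeFn_mulOp m f u] with x h
  rw [h, norm_mul]
  gcongr
  exact f.norm_coe_le_norm x

lemma mulOp_charFun_charL2 (χ ψ : PontryaginDual G) :
    mulOp m (charFun χ) (charL2 m ψ) = charL2 m (χ * ψ) := by
  rw [charL2, mulOp_toLp, ← charFun_mul, charL2]

lemma star_charFun_mul_charFun (χ : PontryaginDual G) : star (charFun χ) * charFun χ = 1 := by
  rw [← charFun_inv, ← charFun_mul, inv_mul_cancel, charFun_one]

lemma norm_mulOp_charFun (χ : PontryaginDual G) (u : Lp ℂ 2 m) :
    ‖mulOp m (charFun χ) u‖ = ‖u‖ := by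
  have h : inner ℂ (mulOp m (charFun χ) u) (mulOp m (charFun χ) u) = inner ℂ u u := by
    rw [inner_mulOp, ← mul_apply_eq_comp, ← mulOp_mul, star_charFun_mul_charFun,
      mulOp_one, one_apply_eq_self]
  rw [inner_self_eq_norm_sq_to_K, inner_self_eq_norm_sq_to_K] at h
  have h' : ‖mulOp m (charFun χ) u‖ ^ 2 = ‖u‖ ^ 2 := by exact_mod_cast h
  exact (sq_eq_sq₀ (norm_nonneg _) (norm_nonneg _)).1 h'

lemma inner_charL2_mulOp_charFun (χ ψ : PontryaginDual G) (u : Lp ℂ 2 m) :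
    inner ℂ (charL2 m ψ) (mulOp m (charFun χ) u) = inner ℂ (charL2 m (χ⁻¹ * ψ)) u := by
  rw [← mulOp_charFun_charL2, inner_mulOp, charFun_inv, star_star]

end Multiplication

/-! ### Toeplitz operators on the Hardy space -/

section Toeplitz

variable {G : Type*} [CommGroup G] [TopologicalSpace G] [IsTopologicalGroup G] [CompactSpace G]
  [MeasurableSpace G] [BorelSpace G] (m : Measure G) [m.IsHaarMeasure] [IsProbabilityMeasure m]
  (P : GroupCone (PontryaginDual G))

variable {m P} in
lemma mem_H2 {u : Lp ℂ 2 m} : u ∈ H2 m P ↔ ∀ χ, χ ∉ P → inner ℂ (charL2 m χ) u = 0 := by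
  simp_rw [← fourierCoeff_eq_inner]
  rfl

lemma isClosed_H2 : IsClosed (H2 m P : Set (Lp ℂ 2 m)) := by
  have : (H2 m P : Set (Lp ℂ 2 m)) =
      ⋂ χ : PontryaginDual G, ⋂ _ : χ ∉ P, {u | inner ℂ (charL2 m χ) u = 0} := by
    ext u
    simp [mem_H2]
  rw [this]
  exact isClosed_iInter fun χ => isClosed_iInter fun _ => isClosed_eq (by fun_prop) (by fun_prop)

instance completeSpace_H2 : CompleteSpace (H2 m P) :=
  (isClosed_H2 m P).completeSpace_coe

/-- The Toeplitz operator with continuous symbol `f`: multiplication by `f` followed by the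
orthogonal projection onto `H²(G)`. -/
noncomputable def toeplitz (f : C(G, ℂ)) : H2 m P →L[ℂ] H2 m P :=
  (H2 m P).orthogonalProjectionOnto ∘L mulOp m f ∘L (H2 m P).subtypeL

lemma toeplitz_apply (f : C(G, ℂ)) (u : H2 m P) :
    toeplitz m P f u = (H2 m P).orthogonalProjectionOnto (mulOp m f u) := rfl

lemma inner_toeplitz (f : C(G, ℂ)) (u v : H2 m P) :
    inner ℂ u (toeplitz m P f v) = inner ℂ (u : Lp ℂ 2 m) (mulOp m f v) := by
  rw [toeplitz_apply, Submodule.inner_orthogonalProjectionOnto_eq_of_mem_left]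

lemma norm_toeplitz_apply_le (f : C(G, ℂ)) (u : H2 m P) :
    ‖toeplitz m P f u‖ ≤ ‖mulOp m f u‖ := by
  rw [toeplitz_apply]
  exact (H2 m P).norm_orthogonalProjectionOnto_apply_le (mulOp m f u)

lemma norm_toeplitz_le (f : C(G, ℂ)) : ‖toeplitz m P f‖ ≤ ‖f‖ :=
  ContinuousLinearMap.opNorm_le_bound _ (norm_nonneg f) fun u =>
    (norm_toeplitz_apply_le m P f u).trans (norm_mulOp_le m f u)

lemma toeplitz_sub (f g : C(G, ℂ)) :
    toeplitz m P (f - g) = toeplitz m P f - toeplitz m P g := by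
  ext1 u
  simp [toeplitz_apply]

lemma toeplitz_one : toeplitz m P 1 = 1 := by
  ext1 u
  simp [toeplitz_apply, mulOp_one]

lemma star_toeplitz (f : C(G, ℂ)) : star (toeplitz m P f) = toeplitz m P (star f) := by
  rw [ContinuousLinearMap.star_eq_adjoint, eq_comm, ContinuousLinearMap.eq_adjoint_iff]
  intro u v
  rw [inner_toeplitz, ← inner_conj_symm, inner_toeplitz, inner_conj_symm, inner_mulOp, star_star]

/-- The functions whose multiplication operator preserves `H²(G)`. -/
noncomputable def analyticAlg : Subalgebra ℂ C(G, ℂ) where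
  carrier := {a | ∀ u ∈ H2 m P, mulOp m a u ∈ H2 m P}
  mul_mem' {a b} ha hb u hu := by
    rw [mulOp_mul]
    exact ha _ (hb u hu)
  add_mem' {a b} ha hb u hu := by
    rw [map_add]
    exact (H2 m P).add_mem (ha u hu) (hb u hu)
  algebraMap_mem' c u hu := by
    rw [Algebra.algebraMap_eq_smul_one, map_smul, mulOp_one]
    exact (H2 m P).smul_mem c hu

variable {m P} in
lemma mem_analyticAlg {a : C(G, ℂ)} :
    a ∈ analyticAlg m P ↔ ∀ u ∈ H2 m P, mulOp m a u ∈ H2 m P := Iff.rfl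

lemma isClosed_analyticAlg : IsClosed (analyticAlg m P : Set C(G, ℂ)) := by
  have : (analyticAlg m P : Set C(G, ℂ)) =
      ⋂ u : Lp ℂ 2 m, ⋂ _ : u ∈ H2 m P, (fun a => mulOp m a u) ⁻¹' (H2 m P) := by
    ext a
    simp [mem_analyticAlg]
  rw [this]
  exact isClosed_iInter fun u => isClosed_iInter fun _ => (isClosed_H2 m P).preimage (by fun_prop)

variable {m P}

lemma charFun_mem_analyticAlg {χ : PontryaginDual G} (hχ : χ ∈ P) :
    charFun χ ∈ analyticAlg m P := fun u hu => by
  rw [mem_H2] at hu ⊢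
  intro ψ hψ
  rw [inner_charL2_mulOp_charFun]
  refine hu _ fun h => hψ ?_
  simpa using mul_mem hχ h

lemma coe_toeplitz_apply_of_mem {a : C(G, ℂ)} (ha : a ∈ analyticAlg m P) (u : H2 m P) :
    (toeplitz m P a u : Lp ℂ 2 m) = mulOp m a u := by
  rw [toeplitz_apply]
  exact Submodule.starProjection_eq_self_iff.2 (ha u u.2)

lemma toeplitz_mul_of_mem (f : C(G, ℂ)) {a : C(G, ℂ)} (ha : a ∈ analyticAlg m P) :
    toeplitz m P (f * a) = toeplitz m P f * toeplitz m P a := by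
  ext1 u
  rw [mul_apply_eq_comp, toeplitz_apply, toeplitz_apply, coe_toeplitz_apply_of_mem ha,
    mulOp_mul, mul_apply_eq_comp]

lemma toeplitz_star_mul_of_mem (f : C(G, ℂ)) {a : C(G, ℂ)} (ha : a ∈ analyticAlg m P) :
    toeplitz m P (star a * f) = star (toeplitz m P a) * toeplitz m P f := by
  have h := (congrArg star (toeplitz_mul_of_mem (star f) ha)).trans (star_mul _ _)
  rwa [star_toeplitz, star_toeplitz m P (star f), star_star, star_mul, star_star] at h

lemma exp_apply (g : C(G, ℂ)) (x : G) : NormedSpace.exp g x = Complex.exp (g x) := by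
  have h := NormedSpace.map_exp (ContinuousMap.evalAlgHom ℂ ℂ x : C(G, ℂ) →ₐ[ℂ] ℂ)
    (ContinuousEvalConst.continuous_eval_const x) g
  rw [Complex.exp_eq_exp_ℂ]
  exact h

lemma isUnit_toeplitz_exp_of_mem {a : C(G, ℂ)} (ha : a ∈ analyticAlg m P) :
    IsUnit (toeplitz m P (NormedSpace.exp a)) := by
  have key {b : C(G, ℂ)} (hb : b ∈ analyticAlg m P) :
      toeplitz m P (NormedSpace.exp (-b)) * toeplitz m P (NormedSpace.exp b) = 1 := by
    have hb' : NormedSpace.exp b ∈ analyticAlg m P :=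
      NormedSpace.exp_mem (R := ℂ) (isClosed_analyticAlg m P) hb
    rw [← toeplitz_mul_of_mem _ hb', ← toeplitz_one]
    congr 1
    ext x
    simp [exp_apply, ← Complex.exp_add]
  refine ⟨⟨_, toeplitz m P (NormedSpace.exp (-a)), ?_, key ha⟩, rfl⟩
  simpa using key (neg_mem ha)

variable [T2Space G] [m.Regular] [HasMemOrInvMem P]

/-- The Toeplitz operator of an exponential is invertible. Up to a factor close to `1`, the symbol
is `exp (a + conj b)` with `a` and `b` analytic, and the factors `exp a` and `conj (exp b)`
contribute invertible operators. -/
theorem isUnit_toeplitz_exp (g : C(G, ℂ)) : IsUnit (toeplitz m P (NormedSpace.exp g)) := by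
  have hcont : ContinuousAt (NormedSpace.exp : C(G, ℂ) → C(G, ℂ)) 0 :=
    (NormedSpace.exp_continuous (𝔸 := C(G, ℂ))).continuousAt
  obtain ⟨δ, hδ, hδ'⟩ := Metric.continuousAt_iff.1 hcont 1 one_pos
  obtain ⟨p, hp, hgp⟩ := Metric.dense_iff.1 (dense_span_charFun m) g δ hδ
  have hdec : ∀ p ∈ Submodule.span ℂ (Set.range (charFun (G := G))),
      ∃ a ∈ analyticAlg m P, ∃ b ∈ analyticAlg m P, p = a + star b := by
    intro p hp
    induction hp using Submodule.span_induction with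
    | mem x hx =>
      obtain ⟨χ, rfl⟩ := hx
      rcases mem_or_inv_mem P χ with h | h
      · exact ⟨_, charFun_mem_analyticAlg h, 0, zero_mem _, by simp⟩
      · exact ⟨0, zero_mem _, _, charFun_mem_analyticAlg h, by simp [charFun_inv]⟩
    | zero => exact ⟨0, zero_mem _, 0, zero_mem _, by simp⟩
    | add x y _ _ hx hy =>
      obtain ⟨a, ha, b, hb, rfl⟩ := hx
      obtain ⟨c, hc, d, hd, rfl⟩ := hy
      exact ⟨a + c, add_mem ha hc, b + d, add_mem hb hd, by rw [star_add]; ring⟩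
    | smul c x _ hx =>
      obtain ⟨a, ha, b, hb, rfl⟩ := hx
      exact ⟨c • a, Subalgebra.smul_mem _ ha c, star c • b, Subalgebra.smul_mem _ hb _, by
        rw [smul_add, star_smul, star_star]⟩
  obtain ⟨a, ha, b, hb, rfl⟩ := hdec p hgp
  set r := g - (a + star b)
  have hr : ‖NormedSpace.exp r - 1‖ < 1 := by
    have := @hδ' r (by rwa [dist_zero_right, ← dist_eq_norm, dist_comm])
    rwa [NormedSpace.exp_zero, dist_eq_norm] at this
  have hexp : NormedSpace.exp g =
      star (NormedSpace.exp b) * (NormedSpace.exp r * NormedSpace.exp a) := by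
    ext x
    simp only [ContinuousMap.mul_apply, ContinuousMap.star_apply, exp_apply, RCLike.star_def,
      ← Complex.exp_conj, ← Complex.exp_add]
    congr 1
    simp only [r, ContinuousMap.sub_apply, ContinuousMap.add_apply, ContinuousMap.star_apply,
      RCLike.star_def]
    ring
  have hmem {c : C(G, ℂ)} (hc : c ∈ analyticAlg m P) : NormedSpace.exp c ∈ analyticAlg m P :=
    NormedSpace.exp_mem (R := ℂ) (isClosed_analyticAlg m P) hc
  rw [hexp, toeplitz_star_mul_of_mem _ (hmem hb), toeplitz_mul_of_mem _ (hmem ha)]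
  refine (isUnit_toeplitz_exp_of_mem hb).star.mul (IsUnit.mul ?_ (isUnit_toeplitz_exp_of_mem ha))
  have hsmall : ‖1 - toeplitz m P (NormedSpace.exp r)‖ < 1 := by
    rw [← toeplitz_one, ← toeplitz_sub]
    refine (norm_toeplitz_le m P _).trans_lt ?_
    rwa [norm_sub_rev]
  have h := isUnit_one_sub_of_norm_lt_one (R := H2 m P →L[ℂ] H2 m P) hsmall
  rwa [sub_sub_cancel] at h

end Toeplitz

/-! ### Fredholm operators -/

section Fredholm

variable {E : Type*} [NormedAddCommGroup E] [NormedSpace ℂ E]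

lemma isFredholm_mul {A B : E →L[ℂ] E} (hA : A.IsFredholm) (hB : B.IsFredholm) :
    (A * B).IsFredholm ∧
      (A * B).toLinearMap.index = A.toLinearMap.index + B.toLinearMap.index := by
  obtain ⟨A', hA'⟩ := hA.exists_isQuasiInverse
  obtain ⟨B', hB'⟩ := hB.exists_isQuasiInverse
  refine ⟨.of_isQuasiInverse (v := B' * A') (hB'.comp hA'), ?_⟩
  have := hA.finite_ker
  have := hB.finite_ker
  have : FiniteDimensional ℂ (E ⧸ A.range) := hA.finite_coker
  have : FiniteDimensional ℂ (E ⧸ B.range) := hB.finite_coker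
  exact LinearMap.index_comp A.toLinearMap (f := B.toLinearMap)

/-- An operator `V` with a left inverse `S` that has a finite-dimensional kernel is Fredholm,
and so is `S`: the operator `1 - V * S` maps into the kernel of `S`. -/
lemma isFredholm_of_leftInverse {S V : E →L[ℂ] E} (h : S * V = 1)
    (hS : FiniteDimensional ℂ S.ker) :
    (S.IsFredholm ∧ S.toLinearMap.index = Module.finrank ℂ S.ker) ∧
      V.IsFredholm ∧ V.toLinearMap.index = -Module.finrank ℂ S.ker := by
  have hx (x : E) : S (V x) = x := congr($h x)
  have hSV : LinearMap.IsQuasiInverse S.toLinearMap V.toLinearMap := by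
    constructor
    · have : S.toLinearMap ∘ₗ V.toLinearMap = LinearMap.id := by
        ext x
        exact hx x
      rw [LinearMap.IsLeftQuasiInverse, this]
    · rw [LinearMap.IsRightQuasiInverse, LinearMap.FiniteRangeSetoid.equiv_iff_hasFiniteRange,
        LinearMap.HasFiniteRange, Submodule.fg_iff_finiteDimensional]
      refine Submodule.finiteDimensional_of_le (S₂ := S.ker) ?_
      rintro _ ⟨x, rfl⟩
      simp [hx]
  have hSF : S.IsFredholm := .of_isQuasiInverse (v := V) hSV.symm
  have hVF : V.IsFredholm := .of_isQuasiInverse (v := S) hSV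
  have hSi : S.toLinearMap.index = Module.finrank ℂ S.ker :=
    LinearMap.index_of_surjective fun x => ⟨V x, hx x⟩
  refine ⟨⟨hSF, hSi⟩, hVF, ?_⟩
  have h1 := (isFredholm_mul hSF hVF).2
  rw [h, hSi] at h1
  have h2 : (1 : E →L[ℂ] E).toLinearMap.index = 0 := LinearMap.index_id
  omega

lemma isFredholm_of_isUnit {U : E →L[ℂ] E} (hU : IsUnit U) :
    U.IsFredholm ∧ U.toLinearMap.index = 0 := by
  obtain ⟨S, hUS, hSU⟩ := isUnit_iff_exists.1 hU
  have hker : U.ker = ⊥ := by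
    rw [LinearMap.ker_eq_bot']
    intro x hx
    rw [← show S (U x) = x from congr($hSU x)]
    exact (congrArg S hx).trans (map_zero S)
  have h := (isFredholm_of_leftInverse hUS (by rw [hker]; infer_instance)).1
  rwa [hker, finrank_bot] at h

lemma isFredholm_of_isUnit_mul {U A : E →L[ℂ] E} (hU : IsUnit U) (h : (U * A).IsFredholm) :
    A.IsFredholm := by
  obtain ⟨S, hUS, hSU⟩ := isUnit_iff_exists.1 hU
  have hS : IsUnit S := isUnit_iff_exists.2 ⟨U, hSU, hUS⟩
  have := (isFredholm_mul (isFredholm_of_isUnit hS).1 h).1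
  rwa [← mul_assoc, hSU, one_mul] at this

lemma isFredholm_of_mul_isUnit {U A : E →L[ℂ] E} (hU : IsUnit U) (h : (A * U).IsFredholm) :
    A.IsFredholm := by
  obtain ⟨S, hUS, hSU⟩ := isUnit_iff_exists.1 hU
  have hS : IsUnit S := isUnit_iff_exists.2 ⟨U, hSU, hUS⟩
  have := (isFredholm_mul h (isFredholm_of_isUnit hS).1).1
  rwa [mul_assoc, hUS, mul_one] at this

lemma finiteDimensional_ker_of_leftInverse {S V : E →L[ℂ] E} (h : S * V = 1)
    (hV : V.IsFredholm) : FiniteDimensional ℂ S.ker := by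
  rw [← Submodule.fg_iff_finiteDimensional]
  refine hV.finite_coker.fg_of_disjoint ?_
  rw [Submodule.disjoint_def]
  rintro _ hx ⟨x, rfl⟩
  have h' : S (V x) = x := congr($h x)
  have hx' : S (V x) = 0 := hx
  rw [← h', hx']
  simp

end Fredholm

/-! ### Toeplitz operators with characters as symbols -/

section CharacterSymbol

variable {G : Type*} [CommGroup G] [TopologicalSpace G] [IsTopologicalGroup G] [CompactSpace G]
  [MeasurableSpace G] [BorelSpace G] {m : Measure G} [m.IsHaarMeasure] [IsProbabilityMeasure m]
  {P : GroupCone (PontryaginDual G)}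

lemma mem_gap {χ ψ : PontryaginDual G} : ψ ∈ gap P χ ↔ ψ ∈ P ∧ χ⁻¹ * ψ ∉ P := by
  rw [gap, Set.mem_sdiff, Set.mem_smul_set_iff_inv_smul_mem]
  rfl

lemma coe_charH2 (χ : P) : (charH2 m P χ : Lp ℂ 2 m) = charL2 m χ := rfl

lemma star_toeplitz_charFun_mul {χ : PontryaginDual G} (hχ : χ ∈ P) :
    star (toeplitz m P (charFun χ)) * toeplitz m P (charFun χ) = 1 := by
  rw [← toeplitz_star_mul_of_mem _ (charFun_mem_analyticAlg hχ), star_charFun_mul_charFun,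
    toeplitz_one]

lemma inner_charL2_star_toeplitz_charFun (χ : PontryaginDual G) (ψ : P) (u : H2 m P) :
    inner ℂ (charL2 m ψ) (star (toeplitz m P (charFun χ)) u : Lp ℂ 2 m) =
      inner ℂ (charL2 m (χ * ψ)) (u : Lp ℂ 2 m) := by
  change inner ℂ (charH2 m P ψ) (star (toeplitz m P (charFun χ)) u) = _
  rw [star_toeplitz, inner_toeplitz, coe_charH2, ← charFun_inv, inner_charL2_mulOp_charFun,
    inv_inv]

/-- The characters in `X₊ \ χX₊`, as elements of `H²(G)`. -/
noncomputable def gapChar (m : Measure G) [m.IsHaarMeasure] [IsProbabilityMeasure m]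
    (P : GroupCone (PontryaginDual G)) (χ : PontryaginDual G) (ψ : gap P χ) : H2 m P :=
  charH2 m P ⟨ψ, ψ.2.1⟩

lemma linearIndependent_gapChar (χ : PontryaginDual G) :
    LinearIndependent ℂ (gapChar m P χ) := by
  refine LinearIndependent.of_comp (H2 m P).subtype ?_
  exact (orthonormal_charL2 m).linearIndependent.comp (fun ψ : gap P χ => (ψ : PontryaginDual G))
    Subtype.val_injective

variable [T2Space G] [m.Regular]

variable (m) in
lemma eq_of_forall_inner_charL2 {u v : Lp ℂ 2 m}
    (h : ∀ χ, inner ℂ (charL2 m χ) u = inner ℂ (charL2 m χ) v) : u = v :=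
  sub_eq_zero.1 <| eq_zero_of_forall_inner_charL2 m _ fun χ => by rw [inner_sub_right, h, sub_self]

lemma eq_of_forall_inner_charH2 {u v : H2 m P}
    (h : ∀ χ : P, inner ℂ (charH2 m P χ) u = inner ℂ (charH2 m P χ) v) : u = v := by
  refine Subtype.ext (eq_of_forall_inner_charL2 m fun χ => ?_)
  by_cases hχ : χ ∈ P
  · exact h ⟨χ, hχ⟩
  · rw [mem_H2.1 u.2 χ hχ, mem_H2.1 v.2 χ hχ]

lemma mem_ker_star_toeplitz_charFun {χ : PontryaginDual G} {u : H2 m P} :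
    u ∈ (star (toeplitz m P (charFun χ))).ker ↔
      ∀ ψ ∈ P, inner ℂ (charL2 m (χ * ψ)) (u : Lp ℂ 2 m) = 0 := by
  rw [LinearMap.mem_ker]
  constructor
  · intro h ψ hψ
    have h' : star (toeplitz m P (charFun χ)) u = 0 := h
    rw [← inner_charL2_star_toeplitz_charFun χ ⟨ψ, hψ⟩ u, h']
    simp
  · intro h
    refine eq_of_forall_inner_charH2 fun ψ => ?_
    rw [inner_zero_right]
    exact (inner_charL2_star_toeplitz_charFun χ ψ u).trans (h ψ ψ.2)

lemma gapChar_mem_ker (χ : PontryaginDual G) (ψ : gap P χ) :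
    gapChar m P χ ψ ∈ (star (toeplitz m P (charFun χ))).ker := by
  rw [mem_ker_star_toeplitz_charFun]
  intro ξ hξ
  refine (orthonormal_charL2 m).2 fun h => (mem_gap.1 ψ.2).2 ?_
  change χ * ξ = ψ at h
  rwa [← h, inv_mul_cancel_left]

/-- If `X₊ \ χX₊` is finite, its characters span the kernel of the adjoint of `T_χ`. -/
lemma ker_star_toeplitz_charFun {χ : PontryaginDual G} (hχ : (gap P χ).Finite) :
    (star (toeplitz m P (charFun χ))).ker = Submodule.span ℂ (Set.range (gapChar m P χ)) := by
  have := hχ.fintype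
  apply le_antisymm
  · intro u hu
    rw [mem_ker_star_toeplitz_charFun] at hu
    have key : (u : Lp ℂ 2 m) =
        ∑ ψ : gap P χ, inner ℂ (charL2 m ψ) (u : Lp ℂ 2 m) • charL2 m ψ := by
      refine eq_of_forall_inner_charL2 m fun ξ => ?_
      rw [inner_sum]
      simp_rw [inner_smul_right]
      by_cases hξ : ξ ∈ gap P χ
      · rw [Finset.sum_eq_single ⟨ξ, hξ⟩]
        · rw [inner_self_eq_norm_sq_to_K, (orthonormal_charL2 m).1]
          simp
        · intro ψ _ hψ
          rw [(orthonormal_charL2 m).2 fun h => hψ (Subtype.ext h.symm), mul_zero]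
        · simp
      · rw [Finset.sum_eq_zero]
        · by_cases hξP : ξ ∈ P
          · have := not_not.1 fun h => hξ (mem_gap.2 ⟨hξP, h⟩)
            rw [← hu _ this, mul_inv_cancel_left]
          · exact mem_H2.1 u.2 ξ hξP
        · intro ψ _
          have hne : ξ ≠ ψ := fun h => hξ (by rw [h]; exact ψ.2)
          rw [(orthonormal_charL2 m).2 hne, mul_zero]
    have : u = ∑ ψ : gap P χ, inner ℂ (charL2 m ψ) (u : Lp ℂ 2 m) • gapChar m P χ ψ := by
      refine Subtype.ext (key.trans ?_)
      simp only [Submodule.coe_sum, Submodule.coe_smul]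
      rfl
    rw [this]
    exact Submodule.sum_mem _ fun ψ _ => Submodule.smul_mem _ _ (Submodule.subset_span ⟨ψ, rfl⟩)
  · rw [Submodule.span_le]
    rintro _ ⟨ψ, rfl⟩
    exact gapChar_mem_ker χ ψ

lemma finite_gap_of_finiteDimensional_ker {χ : PontryaginDual G}
    (h : FiniteDimensional ℂ (star (toeplitz m P (charFun χ))).ker) : (gap P χ).Finite := by
  let c : gap P χ → (star (toeplitz m P (charFun χ))).ker := fun ψ => ⟨_, gapChar_mem_ker χ ψ⟩
  have hc : LinearIndependent ℂ c :=
    LinearIndependent.of_comp (Submodule.subtype _) (linearIndependent_gapChar χ)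
  have := hc.finite
  exact Set.toFinite _

lemma finrank_ker_star_toeplitz_charFun {χ : PontryaginDual G} (hχ : (gap P χ).Finite) :
    FiniteDimensional ℂ (star (toeplitz m P (charFun χ))).ker ∧
      Module.finrank ℂ (star (toeplitz m P (charFun χ))).ker = (gap P χ).ncard := by
  have := hχ.fintype
  rw [ker_star_toeplitz_charFun hχ, finrank_span_eq_card (linearIndependent_gapChar χ),
    Set.ncard_eq_toFinset_card', Set.toFinset_card]
  exact ⟨FiniteDimensional.span_of_finite ℂ (Set.finite_range _), rfl⟩

lemma isFredholm_toeplitz_charFun {χ : PontryaginDual G} (hχ : χ ∈ P) (hg : (gap P χ).Finite) :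
    ((star (toeplitz m P (charFun χ))).IsFredholm ∧
      (star (toeplitz m P (charFun χ))).toLinearMap.index = (gap P χ).ncard) ∧
    (toeplitz m P (charFun χ)).IsFredholm ∧
      (toeplitz m P (charFun χ)).toLinearMap.index = -(gap P χ).ncard := by
  obtain ⟨h1, h2⟩ := finrank_ker_star_toeplitz_charFun (m := m) hg
  have h := isFredholm_of_leftInverse (star_toeplitz_charFun_mul (m := m) hχ) h1
  rwa [h2] at h

variable [HasMemOrInvMem P]

lemma toeplitz_char_mul_exp_of_mem {χ₁ χ₂ : PontryaginDual G} (h₁ : χ₁ ∈ P) (h₂ : χ₂ ∈ P)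
    {f g : C(G, ℂ)} (hf : ∀ x, f x = ((χ₁ * χ₂⁻¹ : PontryaginDual G) x : ℂ) * Complex.exp (g x)) :
    toeplitz m P f = star (toeplitz m P (charFun χ₂)) *
      (toeplitz m P (NormedSpace.exp g) * toeplitz m P (charFun χ₁)) := by
  rw [← toeplitz_mul_of_mem _ (charFun_mem_analyticAlg h₁),
    ← toeplitz_star_mul_of_mem _ (charFun_mem_analyticAlg h₂)]
  congr 1
  ext x
  rw [hf, ← charFun_inv, ← charFun_apply, charFun_mul]
  simp only [ContinuousMap.mul_apply, exp_apply]
  ring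

lemma toeplitz_charFun_one_isUnit : IsUnit (toeplitz m P (charFun (1 : PontryaginDual G))) := by
  rw [charFun_one, toeplitz_one]
  exact isUnit_one

lemma gap_one : gap P (1 : PontryaginDual G) = ∅ := by
  ext ψ
  simp [mem_gap]

/-- A Toeplitz operator with symbol `χ exp g`, where `χ` has rotation index `n`, is Fredholm with
index `-n`. -/
theorem isFredholm_toeplitz_of_hasCharIndex {χ : PontryaginDual G} {f g : C(G, ℂ)} {n : ℤ}
    (hf : ∀ x, f x = (χ x : ℂ) * Complex.exp (g x)) (hn : HasCharIndex P χ n) :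
    (toeplitz m P f).IsFredholm ∧ (toeplitz m P f).toLinearMap.index = -n := by
  have key : ∃ χ₁ ∈ P, ∃ χ₂ ∈ P, χ = χ₁ * χ₂⁻¹ ∧ (gap P χ₁).Finite ∧ (gap P χ₂).Finite ∧
      n = (gap P χ₁).ncard - (gap P χ₂).ncard := by
    rcases hn with ⟨h, hfin, rfl⟩ | h
    · exact ⟨χ, h, 1, one_mem P, by simp, hfin, by simp [gap_one], by simp [gap_one]⟩
    · exact h
  obtain ⟨χ₁, h₁, χ₂, h₂, rfl, hg₁, hg₂, rfl⟩ := key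
  rw [toeplitz_char_mul_exp_of_mem h₁ h₂ hf]
  obtain ⟨-, hV, hVi⟩ := isFredholm_toeplitz_charFun (m := m) h₁ hg₁
  obtain ⟨⟨hS, hSi⟩, -⟩ := isFredholm_toeplitz_charFun (m := m) h₂ hg₂
  obtain ⟨hU, hUi⟩ := isFredholm_of_isUnit (isUnit_toeplitz_exp (m := m) (P := P) g)
  obtain ⟨hUV, hUVi⟩ := isFredholm_mul hU hV
  obtain ⟨hSUV, hSUVi⟩ := isFredholm_mul hS hUV
  refine ⟨hSUV, ?_⟩
  rw [hSUVi, hUVi, hSi, hUi, hVi]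
  ring

/-- If the Toeplitz operator with symbol `χ exp g` is Fredholm, then `χ` has a rotation index. -/
theorem mem_indexedChars_of_isFredholm {χ : PontryaginDual G} {f g : C(G, ℂ)}
    (hf : ∀ x, f x = (χ x : ℂ) * Complex.exp (g x)) (h : (toeplitz m P f).IsFredholm) :
    χ ∈ indexedChars P := by
  have hU := isUnit_toeplitz_exp (m := m) (P := P) g
  rcases mem_or_inv_mem P χ with hχ | hχ
  · rw [toeplitz_char_mul_exp_of_mem hχ (one_mem P) (by simpa using hf)] at h
    have h1 := isFredholm_of_isUnit_mul hU
      (isFredholm_of_isUnit_mul toeplitz_charFun_one_isUnit.star h)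
    have hg := finite_gap_of_finiteDimensional_ker
      (finiteDimensional_ker_of_leftInverse (star_toeplitz_charFun_mul hχ) h1)
    exact ⟨_, Or.inl ⟨hχ, hg, rfl⟩⟩
  · rw [toeplitz_char_mul_exp_of_mem (one_mem P) hχ (by simpa using hf)] at h
    have h1 := isFredholm_of_mul_isUnit (hU.mul toeplitz_charFun_one_isUnit) h
    have hg := finite_gap_of_finiteDimensional_ker h1.finite_ker
    exact ⟨_, Or.inr ⟨1, one_mem P, χ⁻¹, hχ, by simp, by simp [gap_one], hg, rfl⟩⟩

end CharacterSymbol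

/-! ### Symbols of Fredholm Toeplitz operators have no zeros -/

/-- A finite-rank operator maps weakly null families to null families. -/
lemma tendsto_of_finiteDimensional_range {E ι : Type*} [NormedAddCommGroup E]
    [InnerProductSpace ℂ E] [CompleteSpace E] (F : E →L[ℂ] E) [FiniteDimensional ℂ F.range]
    {l : Filter ι} {x : ι → E} (hx : ∀ w, Filter.Tendsto (fun i => inner ℂ w (x i)) l (nhds 0)) :
    Filter.Tendsto (fun i => F (x i)) l (nhds 0) := by
  let b := stdOrthonormalBasis ℂ F.range
  have h (y : E) : F y = ∑ j, inner ℂ (F.adjoint (b j : E)) y • (b j : E) := by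
    have h1 := congrArg Subtype.val (b.sum_repr' ⟨F y, LinearMap.mem_range_self _ y⟩)
    simp only [Submodule.coe_sum, Submodule.coe_smul, Submodule.coe_inner] at h1
    simp_rw [ContinuousLinearMap.adjoint_inner_left]
    exact h1.symm
  simp_rw [h]
  have h0 : (0 : E) = ∑ j, (0 : ℂ) • (b j : E) := by simp
  rw [h0]
  exact tendsto_finsetSum _ fun j _ => (hx _).smul_const _

section NoZeros

variable {G : Type*} [CommGroup G] [TopologicalSpace G] [IsTopologicalGroup G] [CompactSpace G]
  [MeasurableSpace G] [BorelSpace G] {m : Measure G} [m.IsHaarMeasure] [IsProbabilityMeasure m]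
  {P : GroupCone (PontryaginDual G)}

lemma tendsto_inner_mulOp_charFun (w : Lp ℂ 2 m) {u : Lp ℂ 2 m}
    (hu : u ∈ Submodule.span ℂ (Set.range (charL2 m))) :
    Filter.Tendsto (fun χ : PontryaginDual G => inner ℂ w (mulOp m (charFun χ) u))
      Filter.cofinite (nhds 0) := by
  induction hu using Submodule.span_induction with
  | mem x hx =>
    obtain ⟨ξ, rfl⟩ := hx
    simp_rw [mulOp_charFun_charL2]
    -- the Fourier coefficients of `w` are square summable by Bessel's inequality
    have h1 := ((orthonormal_charL2 m).inner_products_summable w).tendsto_cofinite_zero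
    have h2 := h1.comp (mul_left_injective ξ).tendsto_cofinite
    rw [tendsto_zero_iff_norm_tendsto_zero]
    have h3 := h2.sqrt
    simp only [Real.sqrt_zero, Function.comp_def, Real.sqrt_sq (norm_nonneg _)] at h3
    refine h3.congr fun χ => ?_
    rw [← norm_inner_symm]
  | zero => simpa using tendsto_const_nhds
  | add x y _ _ hx hy => simpa [inner_add_right] using hx.add hy
  | smul c x _ hx => simpa [inner_smul_right] using hx.const_mul c

variable [HasMemOrInvMem P]

lemma exists_mulOp_charFun_mem_H2 {u : Lp ℂ 2 m}
    (hu : u ∈ Submodule.span ℂ (Set.range (charL2 m))) :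
    ∃ χ ∈ P, mulOp m (charFun χ) u ∈ H2 m P := by
  induction hu using Submodule.span_induction with
  | mem x hx =>
    obtain ⟨ξ, rfl⟩ := hx
    simp_rw [mulOp_charFun_charL2]
    rcases mem_or_inv_mem P ξ with h | h
    · exact ⟨1, one_mem P, (charH2 m P ⟨1 * ξ, by simpa⟩).2⟩
    · exact ⟨ξ⁻¹, h, (charH2 m P ⟨ξ⁻¹ * ξ, by simp⟩).2⟩
  | zero => exact ⟨1, one_mem P, by simp⟩
  | add x y _ _ hx hy =>
    obtain ⟨χ, hχ, h1⟩ := hx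
    obtain ⟨ψ, hψ, h2⟩ := hy
    refine ⟨χ * ψ, mul_mem hχ hψ, ?_⟩
    rw [map_add]
    refine add_mem ?_ ?_
    · rw [mul_comm, charFun_mul, mulOp_mul]
      exact charFun_mem_analyticAlg hψ _ h1
    · rw [charFun_mul, mulOp_mul]
      exact charFun_mem_analyticAlg hχ _ h2
  | smul c x _ hx =>
    obtain ⟨χ, hχ, h1⟩ := hx
    exact ⟨χ, hχ, by rw [map_smul]; exact (H2 m P).smul_mem c h1⟩

variable [T2Space G] [m.Regular]

variable (P) in
/-- The positive cone is infinite, since a nontrivial totally ordered group has no torsion. -/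
lemma infinite_cone [Nontrivial G] (m : Measure G) [m.IsHaarMeasure] [IsProbabilityMeasure m]
    [m.Regular] : Infinite P := by
  obtain ⟨x, y, hxy⟩ := exists_pair_ne G
  obtain ⟨χ, hχ⟩ := exists_char_ne m hxy
  have h1 : χ ≠ 1 := by
    rintro rfl
    simp at hχ
  have key : ∃ ψ ∈ P, ψ ≠ 1 := by
    rcases mem_or_inv_mem P χ with h | h
    · exact ⟨χ, h, h1⟩
    · exact ⟨χ⁻¹, h, inv_ne_one.2 h1⟩
  obtain ⟨ψ, hψ, hψ1⟩ := key
  have hinj : Function.Injective fun n : ℕ => ψ ^ n := by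
    rw [injective_pow_iff_not_isOfFinOrder, isOfFinOrder_iff_pow_eq_one]
    rintro ⟨n, hn, h⟩
    refine hψ1 (eq_one_of_mem_of_inv_mem hψ ?_)
    obtain ⟨k, rfl⟩ := Nat.exists_eq_succ_of_ne_zero hn.ne'
    rw [inv_eq_of_mul_eq_one_left (b := ψ) (a := ψ ^ k) (by rwa [← pow_succ])]
    exact pow_mem hψ k
  exact Infinite.of_injective (fun n : ℕ => (⟨ψ ^ n, pow_mem hψ n⟩ : P)) fun a b h =>
    hinj congr(($h : PontryaginDual G))

/-- If `T_f` is Fredholm, multiplication by `f` is bounded below on `L²(G)`. A trigonometric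
polynomial can be moved into `H²(G)` by multiplication with a character, and as this character
tends to infinity the finite-rank defect of a quasi-inverse of `T_f` disappears. -/
lemma exists_norm_le_mulOp [Nontrivial G] {f : C(G, ℂ)} (h : (toeplitz m P f).IsFredholm) :
    ∃ C : ℝ, 0 ≤ C ∧ ∀ u : Lp ℂ 2 m, ‖u‖ ≤ C * ‖mulOp m f u‖ := by
  obtain ⟨S, hS⟩ := h.exists_isQuasiInverse
  let F : H2 m P →L[ℂ] H2 m P := S ∘L toeplitz m P f - .id ℂ _
  have hF : FiniteDimensional ℂ F.range := by
    have := hS.1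
    rw [LinearMap.IsLeftQuasiInverse, LinearMap.FiniteRangeSetoid.equiv_iff_hasFiniteRange,
      LinearMap.HasFiniteRange, Submodule.fg_iff_finiteDimensional] at this
    exact this
  refine ⟨‖S‖, norm_nonneg S, fun u => ?_⟩
  have hdense := dense_span_charL2 m
  refine hdense.induction (P := fun u => ‖u‖ ≤ ‖S‖ * ‖mulOp m f u‖) (fun u hu => ?_)
    (isClosed_le (by fun_prop) (by fun_prop)) u
  obtain ⟨χ, hχ, hχu⟩ := exists_mulOp_charFun_mem_H2 (P := P) hu
  let x (ψ : P) : H2 m P := ⟨mulOp m (charFun ψ) (mulOp m (charFun χ) u),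
    charFun_mem_analyticAlg ψ.2 _ hχu⟩
  have hx (ψ : P) : (x ψ : Lp ℂ 2 m) = mulOp m (charFun (ψ * χ)) u := by
    rw [charFun_mul, mulOp_mul]
    rfl
  have hweak (w : H2 m P) :
      Filter.Tendsto (fun ψ => inner ℂ w (x ψ)) Filter.cofinite (nhds 0) := by
    have h1 := (tendsto_inner_mulOp_charFun (w : Lp ℂ 2 m) hu).comp
      ((mul_left_injective χ).comp (Subtype.val_injective (p := (· ∈ P)))).tendsto_cofinite
    refine h1.congr fun ψ => ?_
    rw [Submodule.coe_inner, hx]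
    rfl
  have hlim := (tendsto_of_finiteDimensional_range F hweak).norm
  have hinf : Infinite P := infinite_cone P m
  have hle (ψ : P) : ‖u‖ ≤ ‖S‖ * ‖mulOp m f u‖ + ‖F (x ψ)‖ := by
    have h1 : x ψ = S (toeplitz m P f (x ψ)) - F (x ψ) := by
      simp [F]
    have h2 : ‖toeplitz m P f (x ψ)‖ ≤ ‖mulOp m f u‖ := by
      refine (norm_toeplitz_apply_le m P f (x ψ)).trans_eq ?_
      rw [hx, ← mul_apply_eq_comp, ← mulOp_mul, mul_comm, mulOp_mul, mul_apply_eq_comp,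
        norm_mulOp_charFun]
    calc ‖u‖ = ‖x ψ‖ := by rw [Submodule.coe_norm, hx, norm_mulOp_charFun]
      _ = ‖S (toeplitz m P f (x ψ)) - F (x ψ)‖ := by rw [← h1]
      _ ≤ ‖S (toeplitz m P f (x ψ))‖ + ‖F (x ψ)‖ := norm_sub_le _ _
      _ ≤ ‖S‖ * ‖mulOp m f u‖ + ‖F (x ψ)‖ := by
        gcongr
        exact (S.le_opNorm _).trans (by gcongr)
  have := ge_of_tendsto' (hlim.const_add (‖S‖ * ‖mulOp m f u‖)) hle
  simpa using this

/-- The symbol of a Fredholm Toeplitz operator has no zeros. -/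
theorem ne_zero_of_isFredholm_toeplitz [Nontrivial G] {f : C(G, ℂ)}
    (h : (toeplitz m P f).IsFredholm) (x₀ : G) : f x₀ ≠ 0 := by
  intro h0
  obtain ⟨C, hC, hCf⟩ := exists_norm_le_mulOp h
  -- test the lower bound on a bump function supported where `f` is small
  let U : Set G := {x | C * ‖f x‖ < 1 / 2}
  have hU : IsOpen U := isOpen_lt (by fun_prop) (by fun_prop)
  have hx₀ : x₀ ∈ U := by simp [U, h0]
  obtain ⟨g, hg0, hg1, -⟩ := exists_continuous_zero_one_of_isClosed hU.isClosed_compl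
    (isClosed_singleton (x := x₀)) (by simpa using hx₀)
  let u : C(G, ℂ) := ⟨fun x => (g x : ℂ), by fun_prop⟩
  have hle (x : G) : ‖((C : ℂ) • (f * u)) x‖ ≤ 1 / 2 * ‖u x‖ := by
    rw [ContinuousMap.smul_apply, ContinuousMap.mul_apply, norm_smul, norm_mul, ← mul_assoc,
      Complex.norm_real, Real.norm_of_nonneg hC]
    by_cases hx : x ∈ U
    · gcongr
      exact le_of_lt hx
    · have : u x = 0 := by simp [u, hg0 hx]
      simp [this]
  have h1 : C * ‖mulOp m f (ContinuousMap.toLp 2 m ℂ u)‖ ≤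
      1 / 2 * ‖ContinuousMap.toLp 2 m ℂ u‖ := by
    rw [mulOp_toLp]
    calc C * ‖ContinuousMap.toLp 2 m ℂ (f * u)‖
      _ = ‖ContinuousMap.toLp 2 m ℂ ((C : ℂ) • (f * u))‖ := by
          rw [map_smul, norm_smul, Complex.norm_real, Real.norm_of_nonneg hC]
      _ ≤ 1 / 2 * ‖ContinuousMap.toLp 2 m ℂ u‖ := by
          refine Lp.norm_le_mul_norm_of_ae_le_mul ?_
          filter_upwards [ContinuousMap.coeFn_toLp (p := 2) (𝕜 := ℂ) m u,
            ContinuousMap.coeFn_toLp (p := 2) (𝕜 := ℂ) m ((C : ℂ) • (f * u))] with x h1 h2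
          rw [h1, h2]
          exact hle x
  have h2 := hCf (ContinuousMap.toLp 2 m ℂ u)
  have h3 : ContinuousMap.toLp 2 m ℂ u = 0 := by
    rw [← norm_le_zero_iff]
    linarith
  rw [← map_zero (ContinuousMap.toLp 2 m ℂ)] at h3
  have h4 := congr($(ContinuousMap.toLp_injective (p := 2) (𝕜 := ℂ) m h3) x₀)
  simp [u, hg1 rfl] at h4

end NoZeros

/-! ### Factorization of `λ`-Toeplitz operators -/

section Rotation

variable {G : Type*} [CommGroup G] [TopologicalSpace G] [IsTopologicalGroup G] [CompactSpace G]
  [MeasurableSpace G] [BorelSpace G] (m : Measure G) [m.IsHaarMeasure] [IsProbabilityMeasure m]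
  (P : GroupCone (PontryaginDual G))

/-- Translation by `l` on `L²(G)`. -/
noncomputable def rotL2 (l : G) : Lp ℂ 2 m →ₗᵢ[ℂ] Lp ℂ 2 m :=
  Lp.compMeasurePreservingₗᵢ ℂ (· * l) (measurePreserving_mul_right m l)

lemma rotL2_charL2 (l : G) (χ : PontryaginDual G) :
    rotL2 m l (charL2 m χ) = (χ l : ℂ) • charL2 m χ := by
  have h : rotL2 m l (charL2 m χ) = ContinuousMap.toLp 2 m ℂ (translate l (charFun χ)) := rfl
  rw [h, translate_charFun, map_smul]
  rfl

lemma inner_charL2_rotL2 (l : G) (χ : PontryaginDual G) (u : Lp ℂ 2 m) :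
    inner ℂ (charL2 m χ) (rotL2 m l u) = χ l * inner ℂ (charL2 m χ) u := by
  have h := (rotL2 m l).inner_map_map (charL2 m χ) u
  rw [rotL2_charL2, inner_smul_left] at h
  rw [← h, ← mul_assoc, Complex.mul_conj]
  simp

/-- Translation by `l` on `H²(G)`. -/
noncomputable def rotH2 (l : G) : H2 m P →L[ℂ] H2 m P :=
  ((rotL2 m l).toContinuousLinearMap ∘L (H2 m P).subtypeL).codRestrict (H2 m P) fun u => by
    rw [mem_H2]
    intro χ hχ
    change inner ℂ (charL2 m χ) (rotL2 m l u) = 0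
    rw [inner_charL2_rotL2, mem_H2.1 u.2 χ hχ, mul_zero]

variable {m P}

lemma inner_charH2_rotH2 (l : G) (χ : P) (u : H2 m P) :
    inner ℂ (charH2 m P χ) (rotH2 m P l u) =
      (χ : PontryaginDual G) l * inner ℂ (charH2 m P χ) u :=
  inner_charL2_rotL2 m l χ u

variable [T2Space G] [m.Regular]

lemma isUnit_rotH2 (l : G) : IsUnit (rotH2 m P l) := by
  have key (x y : G) (h : x * y = 1) : rotH2 m P x * rotH2 m P y = 1 := by
    ext1 u
    refine eq_of_forall_inner_charH2 fun χ => ?_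
    rw [mul_apply_eq_comp, inner_charH2_rotH2, inner_charH2_rotH2, ← mul_assoc, ← Circle.coe_mul,
      ← map_mul, h, map_one, Circle.coe_one, one_mul, one_apply_eq_self]
  exact isUnit_iff_exists.2 ⟨_, key l l⁻¹ (mul_inv_cancel l), key l⁻¹ l (inv_mul_cancel l)⟩

/-- Bounded operators on `H²(G)` with the same matrix with respect to the positive characters
are equal. -/
lemma eq_of_forall_inner_charH2_apply {A B : H2 m P →L[ℂ] H2 m P}
    (h : ∀ η ξ : P, inner ℂ (charH2 m P η) (A (charH2 m P ξ)) =
      inner ℂ (charH2 m P η) (B (charH2 m P ξ))) : A = B := by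
  ext1 u
  refine eq_of_forall_inner_charH2 fun η => ?_
  have hη : A.adjoint (charH2 m P η) = B.adjoint (charH2 m P η) := by
    refine eq_of_forall_inner_charH2 fun ξ => ?_
    rw [ContinuousLinearMap.adjoint_inner_right, ContinuousLinearMap.adjoint_inner_right,
      ← inner_conj_symm, h]
    exact inner_conj_symm (B (charH2 m P ξ)) (charH2 m P η)
  rw [← ContinuousLinearMap.adjoint_inner_left, hη, ContinuousLinearMap.adjoint_inner_left]

lemma inner_toeplitz_charH2 (f : C(G, ℂ)) (η ξ : P) :
    inner ℂ (charH2 m P η) (toeplitz m P f (charH2 m P ξ)) =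
      inner ℂ (charL2 m ((ξ : PontryaginDual G)⁻¹ * η)) (ContinuousMap.toLp 2 m ℂ f) := by
  rw [inner_toeplitz, coe_charH2, coe_charH2, ← inner_charL2_mulOp_charFun, mulOp_toLp,
    charL2, charL2, mulOp_toLp, mul_comm]

variable [HasMemOrInvMem P]

/-- A `λ`-Toeplitz operator is the Toeplitz operator of its modified symbol followed by
translation by `λ`. -/
theorem eq_rotH2_mul_toeplitz {l : G} {T : H2 m P →L[ℂ] H2 m P}
    (hT : IsLambdaToeplitz m P (fun χ => ((χ : PontryaginDual G) l : ℂ)) T) {φ φl : Lp ℂ 2 m}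
    (hφ : IsSymbol m P T φ) (hφl : IsModifiedSymbol m P l φ φl) {f : C(G, ℂ)}
    (hf : φl =ᵐ[m] f) : T = rotH2 m P l * toeplitz m P f := by
  have hfl : ContinuousMap.toLp 2 m ℂ f = φl :=
    Lp.ext ((ContinuousMap.coeFn_toLp m f).trans hf.symm)
  refine eq_of_forall_inner_charH2_apply fun η ξ => ?_
  rw [mul_apply_eq_comp, inner_charH2_rotH2, inner_toeplitz_charH2, hfl, ← fourierCoeff_eq_inner]
  by_cases h : (ξ : PontryaginDual G)⁻¹ * η ∈ P
  · rw [hφl.1 _ h]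
    have hη : η = ξ * ⟨_, h⟩ := Subtype.ext (mul_inv_cancel_left _ _).symm
    have h1 := hT ξ 1 ⟨_, h⟩
    rw [← hη, mul_one, ← hφ.1] at h1
    rw [h1]
    have h2 : ((η : PontryaginDual G) l : ℂ) =
        (ξ : PontryaginDual G) l * ((ξ : PontryaginDual G)⁻¹ * η : PontryaginDual G) l := by
      rw [← Circle.coe_mul]
      congr 1
      exact congr($(mul_inv_cancel_left (ξ : PontryaginDual G) (η : PontryaginDual G)) l).symm
    rw [h2, mul_assoc, ← mul_assoc _ (conj _), Complex.mul_conj]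
    simp
  · rw [hφl.2 _ h]
    have h' : (η : PontryaginDual G)⁻¹ * ξ ∈ P := by
      have := HasMemOrInvMem.inv_mem_of_notMem P _ h
      rwa [mul_inv, inv_inv, mul_comm] at this
    have hξ : ξ = η * ⟨_, h'⟩ := Subtype.ext (mul_inv_cancel_left _ _).symm
    have hne : (⟨_, h'⟩ : P) ≠ 1 := fun h1 => h <| by
      have h2 : (η : PontryaginDual G)⁻¹ * ξ = 1 := congrArg Subtype.val h1
      rw [inv_mul_eq_one] at h2
      rw [h2, inv_mul_cancel]
      exact one_mem P
    have h1 := hT η ⟨_, h'⟩ 1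
    rw [← hξ, mul_one, ← hφ.2 _ hne] at h1
    rw [h1]
    congr 2
    simp

end Rotation

end LambdaToeplitz

/-! ### The Fredholm criterion and the index -/

theorem corollary2p10 {G : Type*} [CommGroup G] [TopologicalSpace G] [IsTopologicalGroup G]
    [CompactSpace G] [T2Space G] [ConnectedSpace G] [Nontrivial G]
    [MeasurableSpace G] [BorelSpace G]
    (m : MeasureTheory.Measure G) [m.IsHaarMeasure] [m.Regular]
    [MeasureTheory.IsProbabilityMeasure m]
    (P : GroupCone (PontryaginDual G)) [HasMemOrInvMem P]
    (l : G) (T : LambdaToeplitz.H2 m P →L[ℂ] LambdaToeplitz.H2 m P)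
    (hT : LambdaToeplitz.IsLambdaToeplitz m P (fun χ => ((χ : PontryaginDual G) l : ℂ)) T)
    (φ : MeasureTheory.Lp ℂ 2 m) (hφ : LambdaToeplitz.IsSymbol m P T φ)
    (φl : MeasureTheory.Lp ℂ 2 m) (hφl : LambdaToeplitz.IsModifiedSymbol m P l φ φl)
    (f : C(G, ℂ)) (hf : φl =ᵐ[m] f) :
    (T.IsFredholm ↔ f ∈ LambdaToeplitz.PhiSet P) ∧
    (T.IsFredholm →
      (∃ n : ℤ, LambdaToeplitz.HasRotationIndex P f n) ∧
      ∀ n : ℤ, LambdaToeplitz.HasRotationIndex P f n → T.toLinearMap.index = -n) := by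
  have hTf : T = LambdaToeplitz.rotH2 m P l * LambdaToeplitz.toeplitz m P f :=
    LambdaToeplitz.eq_rotH2_mul_toeplitz hT hφ hφl hf
  have hR := LambdaToeplitz.isUnit_rotH2 (m := m) (P := P) l
  have key {n : ℤ} (hn : LambdaToeplitz.HasRotationIndex P f n) :
      T.IsFredholm ∧ T.toLinearMap.index = -n := by
    obtain ⟨χ, g, hχg, hχ⟩ := hn
    obtain ⟨h1, h2⟩ := LambdaToeplitz.isFredholm_toeplitz_of_hasCharIndex (m := m) hχg hχ
    obtain ⟨h3, h4⟩ := LambdaToeplitz.isFredholm_of_isUnit hR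
    obtain ⟨h5, h6⟩ := LambdaToeplitz.isFredholm_mul h3 h1
    rw [hTf]
    exact ⟨h5, by rw [h6, h4, h2, zero_add]⟩
  have hΦ (hF : T.IsFredholm) : ∃ n : ℤ, LambdaToeplitz.HasRotationIndex P f n := by
    rw [hTf] at hF
    have hF' := LambdaToeplitz.isFredholm_of_isUnit_mul hR hF
    obtain ⟨χ, g, hχg⟩ := LambdaToeplitz.exists_char_mul_exp m f
      (LambdaToeplitz.ne_zero_of_isFredholm_toeplitz hF')
    obtain ⟨n, hn⟩ := LambdaToeplitz.mem_indexedChars_of_isFredholm hχg hF'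
    exact ⟨n, χ, g, hχg, hn⟩
  refine ⟨⟨fun hF => ?_, ?_⟩, fun hF => ⟨hΦ hF, fun n hn => (key hn).2⟩⟩
  · obtain ⟨n, χ, g, hχg, hn⟩ := hΦ hF
    exact ⟨χ, ⟨n, hn⟩, g, hχg⟩
  · rintro ⟨χ, ⟨n, hn⟩, g, hχg⟩
    exact (key ⟨χ, g, hχg, hn⟩).1
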